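/- Let $T\subset\mathbb R^d$ be compact, let $T_0\subset T$, and let $k:T\times T\to\mathbb R$ be a covariance function (symmetric and positive semidefinite) that is $\gamma$-Hölder continuous on $T\times T$ for some $\gamma>0$. Let $\mathcal H(T_0)$ be the reproducing kernel Hilbert space of functions on $T_0$ with kernel $k|_{T_0\times T_0}$, and suppose that $k$ is universal on $T_0$, i.e. that $\mathcal H(T_0)$ is dense, in the supremum norm, in the space of uniformly continuous functions $T_0\to\mathbb R$ (which is $C(T_0)$ if $T_0$ is compact). Let $\mu:T\to\mathbb R$ be continuous and $g:T\to\mathbb R$ be a function such that $\mu|_{T_0},\,g|_{T_0}\in\mathcal H(T_0)$. Let $(t_n)_{n\ge1}$ be a sequence in $T_0$ whose set of values is dense in $T_0$, and for $N\ge0$ let $S_N=\{t_1,\dots,t_N\}$ (as a set, so that repetitions are dropped). For $s,s'\in T$ put $$\mu_0^N(s)=\mu(s)+k(s,S_N)\,k(S_N,S_N)^{-1}\,\bigl(g(S_N)-\mu(S_N)\bigr),$$ $$k_0^N(s,s')=k(s,s')-k(s,S_N)\,k(S_N,S_N)^{-1}\,k(S_N,s'),$$ the mean and covariance obtained from a Gaussian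 process with mean $\mu$ and covariance $k$ by conditioning on its having the values of $g$ on $S_N$, and $$\mu_0(s)=\mu(s)+\bigl\langle k(s,\cdot)|_{T_0},(g-\mu)|_{T_0}\bigr\rangle_{\mathcal H(T_0)},$$ $$k_0(s,s')=k(s,s')-\bigl\langle k(s,\cdot)|_{T_0},k(s',\cdot)|_{T_0}\bigr\rangle_{\mathcal H(T_0)}.$$ Then for every $N\ge0$ there is a Gaussian process $\mathbb X^N$ on $T$ with continuous paths, mean $\mu_0^N$ and covariance $k_0^N$, and there is a Gaussian process $\mathbb X$ on $T$ with continuous paths, mean $\mu_0$ and covariance $k_0$. For any such processes, the sequence $(\mathbb X^N)_{N\ge0}$ (that is, the sequence of the laws of the $\mathbb X^N$) is tight in $(C(T),\|\cdot\|_\infty)$, and $\mathbb X^N$ converges weakly to $\mathbb X$ in $(C(T),\|\cdot\|_\infty)$ as $N\to\infty$. -/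

import Mathlib

open MeasureTheory ProbabilityTheory Filter Topology
open scoped NNReal

/-- A covariance function on `X`: a real function of two variables that is symmetric and positive
semidefinite, i.e. `∑ i j, c i * k (x i) (x j) * c j ≥ 0` for all finite families. -/
structure CovKernel (X : Type*) where
  toFun : X → X → ℝ
  posSemidef : (Matrix.of toFun).PosSemidef

namespace CovKernel

instance {X : Type*} : CoeFun (CovKernel X) (fun _ => X → X → ℝ) := ⟨CovKernel.toFun⟩

/-- Restriction of a covariance function to a subset. -/
def restrict {X : Type*} (k : CovKernel X) (S : Set X) : CovKernel S where
  toFun s t := k s t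
  posSemidef := k.posSemidef.submatrix (Subtype.val : S → X)

theorem symm {X : Type*} (k : CovKernel X) (s t : X) : k s t = k t s := by
  simpa using k.posSemidef.1.apply t s

/-- The covariance function with its values seen as multiplication operators on `ℝ`, the form in
which Mathlib's reproducing kernel Hilbert spaces take their kernel. -/
noncomputable def opKernel {X : Type*} (k : CovKernel X) : Matrix X X (ℝ →L[ℝ] ℝ) :=
  Matrix.of fun s t => k s t • ContinuousLinearMap.id ℝ ℝ

theorem opKernel_posSemidef {X : Type*} (k : CovKernel X) : k.opKernel.PosSemidef := by
  refine ((RKHS.posSemidef_tfae (K := k.opKernel)).out 0 2).mpr (And.intro ?_ fun v => ?_)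
  · ext s t
    have h : star (ContinuousLinearMap.id ℝ ℝ) = ContinuousLinearMap.id ℝ ℝ := star_one (ℝ →L[ℝ] ℝ)
    simp [opKernel, Matrix.conjTranspose_apply, k.symm t s, h]
  · have h := k.posSemidef.2 v
    refine h.trans_eq ?_
    simp only [Finsupp.sum, opKernel, Matrix.of_apply]
    rw [Finset.sum_comm]
    refine Finset.sum_congr rfl fun i _ => Finset.sum_congr rfl fun j _ => ?_
    simp
    ring

instance {X : Type*} (k : CovKernel X) : Fact k.opKernel.PosSemidef := ⟨k.opKernel_posSemidef⟩

/-- The reproducing kernel Hilbert space `H(X)` with kernel `k`. -/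
abbrev H {X : Type*} (k : CovKernel X) : Type _ := RKHS.OfKernel k.opKernel

/-- The reproducing property: `k_x = k(·, x)` is an element of `H(X)` that represents the
evaluation at `x`. -/
theorem kerFun_apply {X : Type*} (k : CovKernel X) (x y : X) :
    RKHS.kerFun k.H x (1 : ℝ) y = k y x := by
  rw [RKHS.kerFun_apply, RKHS.OfKernel.kernel_ofKernel]
  simp [opKernel]

theorem inner_kerFun {X : Type*} (k : CovKernel X) (u : k.H) (x : X) :
    inner ℝ u (RKHS.kerFun k.H x (1 : ℝ)) = u x := by
  simp

/-- The function `f` belongs to `H(X)`. -/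
def Mem {X : Type*} (k : CovKernel X) (f : X → ℝ) : Prop := ∃ u : k.H, ⇑u = f

open scoped Classical in
/-- The element of `H(X)` that is the function `f` (only meaningful if `f` belongs to `H(X)`; it is
then unique, because elements of `H(X)` are determined by their values). -/
noncomputable def lift {X : Type*} (k : CovKernel X) (f : X → ℝ) : k.H :=
  if h : k.Mem f then h.choose else 0

theorem coe_lift {X : Type*} {k : CovKernel X} {f : X → ℝ} (h : k.Mem f) : ⇑(k.lift f) = f := by
  rw [lift, dif_pos h]
  exact h.choose_spec

/-- The inner product `⟨f, g⟩` of `H(X)`, for functions `f`, `g` that belong to `H(X)`. -/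
noncomputable def innerH {X : Type*} (k : CovKernel X) (f g : X → ℝ) : ℝ :=
  inner ℝ (k.lift f) (k.lift g)

/-- For every `s : X`, also outside `S`, the function `k(s, ·)` restricted to `S` belongs to the
space `H(S)`. -/
theorem mem_restrict {X : Type*} (k : CovKernel X) (S : Set X) (s : X) :
    (k.restrict S).Mem fun t : S => k s t := by
  let φ : S → (k.restrict S).H := fun x => RKHS.kerFun (k.restrict S).H x (1 : ℝ)
  let ψ : X → k.H := fun x => RKHS.kerFun k.H x (1 : ℝ)
  have hφ : ∀ x y, inner ℝ (φ x) (φ y) = k x y := fun x y => by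
    rw [(k.restrict S).inner_kerFun, (k.restrict S).kerFun_apply]
    exact k.symm y x
  have hψ : ∀ x y, inner ℝ (ψ x) (ψ y) = k x y := fun x y => by
    rw [k.inner_kerFun, k.kerFun_apply, k.symm]
  let Φ : (S →₀ ℝ) →ₗ[ℝ] (k.restrict S).H := Finsupp.linearCombination ℝ φ
  let Ψ : (S →₀ ℝ) →ₗ[ℝ] k.H := Finsupp.linearCombination ℝ fun x : S => ψ x
  have hnorm : ∀ c, ‖Ψ c‖ = ‖Φ c‖ := fun c => by
    rw [← sq_eq_sq₀ (norm_nonneg _) (norm_nonneg _), ← real_inner_self_eq_norm_sq,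
      ← real_inner_self_eq_norm_sq]
    simp only [Φ, Ψ, Finsupp.linearCombination_apply, Finsupp.sum_inner, Finsupp.inner_sum,
      real_inner_smul_left, real_inner_smul_right, hφ, hψ]
  obtain ⟨r, hr⟩ := Φ.rangeRestrict.exists_rightInverse_of_surjective Φ.range_rangeRestrict
  have hr' : ∀ w, Φ (r w) = w := fun w => congrArg Subtype.val (LinearMap.congr_fun hr w)
  let l : StrongDual ℝ (LinearMap.range Φ) :=
    LinearMap.mkContinuous ((innerSL ℝ (ψ s)).toLinearMap ∘ₗ Ψ ∘ₗ r) ‖ψ s‖ fun w => by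
      refine (norm_inner_le_norm (ψ s) (Ψ (r w))).trans_eq ?_
      rw [hnorm, hr']
      rfl
  obtain ⟨L, hL, -⟩ := exists_extension_norm_eq (LinearMap.range Φ) l
  refine ⟨(InnerProductSpace.toDual ℝ (k.restrict S).H).symm L, funext fun x => ?_⟩
  have hx : Φ (Finsupp.single x 1) = φ x := by simp [Φ]
  have hx' : Ψ (Finsupp.single x 1) = ψ x := by simp [Ψ]
  have h0 : Ψ (r ⟨φ x, _, hx⟩) = ψ x := by
    rw [← sub_eq_zero, ← hx', ← map_sub, ← norm_eq_zero, hnorm, map_sub, hr', hx, sub_self,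
      norm_zero]
  rw [← inner_kerFun, InnerProductSpace.toDual_symm_apply]
  refine (hL ⟨φ x, _, hx⟩).trans ?_
  change inner ℝ (ψ s) (Ψ (r ⟨φ x, _, hx⟩)) = _
  rw [h0, hψ]

/-- The kernel is universal: `H(X)` is uniformly dense in the space of real-valued uniformly
continuous functions on `X`. If `X` is compact, these are all continuous functions on `X`. -/
def IsUniversal {X : Type*} [UniformSpace X] (k : CovKernel X) : Prop :=
  ∀ f : X → ℝ, UniformContinuous f → ∀ ε > 0, ∃ h : k.H, ∀ x, |h x - f x| < ε

/-- The mean at `s` of a Gaussian process with mean `μ` and covariance `k`, conditioned on having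
the values of `g` on the finite set `S`: `μ(s) + k(s,S) k(S,S)⁻¹ (g(S) - μ(S))`. -/
noncomputable def condMean {X : Type*} [DecidableEq X] (k : CovKernel X) (μ g : X → ℝ)
    (S : Finset X) (s : X) : ℝ :=
  μ s + (fun a : S => k s a) ⬝ᵥ
    ((Matrix.of fun a b : S => k a b)⁻¹).mulVec (fun b : S => g b - μ b)

/-- The covariance at `s`, `s'` of a Gaussian process with covariance `k`, conditioned on its values
on the finite set `S`: `k(s,s') - k(s,S) k(S,S)⁻¹ k(S,s')`. -/
noncomputable def condCov {X : Type*} [DecidableEq X] (k : CovKernel X) (S : Finset X)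
    (s s' : X) : ℝ :=
  k s s' - (fun a : S => k s a) ⬝ᵥ
    ((Matrix.of fun a b : S => k a b)⁻¹).mulVec (fun b : S => k b s')

/-- The limiting mean `μ₀(s) = μ(s) + ⟨k_s, g - μ⟩`, with the inner product of `H(S)` applied to
restrictions to `S`. -/
noncomputable def limMean {X : Type*} (k : CovKernel X) (μ g : X → ℝ) (S : Set X) (s : X) : ℝ :=
  μ s + (k.restrict S).innerH (fun t => k s t) (fun t => g t - μ t)

/-- The limiting covariance `k₀(s,s') = k(s,s') - ⟨k_s, k_s'⟩`, with the inner product of `H(S)`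
applied to restrictions to `S`. -/
noncomputable def limCov {X : Type*} (k : CovKernel X) (S : Set X) (s s' : X) : ℝ :=
  k s s' - (k.restrict S).innerH (fun t => k s t) (fun t => k s' t)

end CovKernel

/-- The set `{t 0, …, t (N - 1)}` of the first `N` points of a sequence in `S`, as a finite subset
of `X`. -/
def firstPoints {X : Type*} [DecidableEq X] {S : Set X} (t : ℕ → S) (N : ℕ) : Finset X :=
  (Finset.range N).image fun n => (t n : X)

/-- The space `C(X, ℝ)` carries the Borel σ-algebra of the compact-open topology, which for compact
`X` is the topology of the supremum norm. -/
noncomputable instance instMeasurableSpaceContinuousMapReal {X : Type*} [TopologicalSpace X] :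
    MeasurableSpace C(X, ℝ) := borel _

instance instBorelSpaceContinuousMapReal {X : Type*} [TopologicalSpace X] :
    BorelSpace C(X, ℝ) := ⟨rfl⟩

/-- `P` is the law on `C(X, ℝ)` of a Gaussian process with continuous paths, mean `m` and covariance
`c`: under `P` the coordinate process `x ↦ f x` is Gaussian with this mean and covariance. -/
structure IsContGaussianLaw {X : Type*} [TopologicalSpace X] (P : ProbabilityMeasure C(X, ℝ))
    (m : X → ℝ) (c : X → X → ℝ) : Prop where
  isGaussianProcess :
    IsGaussianProcess (fun (x : X) (f : C(X, ℝ)) => f x) (P : Measure C(X, ℝ))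
  mean_eq : ∀ x, ∫ f : C(X, ℝ), f x ∂(P : Measure C(X, ℝ)) = m x
  cov_eq : ∀ x y, covariance (fun f : C(X, ℝ) => f x) (fun f : C(X, ℝ) => f y)
    (P : Measure C(X, ℝ)) = c x y

/-! Put φ_s = k(s,·)|T₀ and u = (g-μ)|T₀ in H(T₀), and let P_N be the orthogonal projection onto the
span of the kernel functions at S_N. Universality makes kernel functions at distinct points linearly
independent, so the Gram matrices are invertible and the conditioning formulas become μ(s) + ⟨φ_s,
P_N u⟩ and k(s,s') - ⟨φ_s, P_N φ_s'⟩ (`condMean_eq`, `condCov_eq`). The limiting mean and covariance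
are the same expressions with the identity in place of P_N. Density of (t_n) and continuity of the
kernel functions give P_N → id strongly, hence uniform convergence of the means and pointwise
convergence of the covariances.

For tightness, embed H(T₀) isometrically into H(T) by J, with J* k_s = φ_s. Then 1 - J P_N J* is an
orthogonal projection, and the conditional covariance is the Gram kernel of the projected vectors
k_s. Since projections contract, the increment variances are at most those of k, with a Hölder bound
independent of N. Gaussian tails and chaining over dyadic nets then give tightness
(`isTightMeasureSet_of_isContGaussianLaw`).

By Prokhorov's theorem the laws have cluster points. The finite-dimensional characteristic functions
pass to them and determine them, so the whole sequence converges (`HasGaussianCharFun.tendsto`).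
Existence follows by the same compactness, from approximations with finite-dimensional feature maps
(`exists_isContGaussianLaw`). -/

/-! ### Dyadic nets in Euclidean space -/

/-- A bounded subset of a Euclidean space has finite `2⁻ⁿ`-nets whose cardinality grows at most
exponentially in `n`. -/
theorem EuclideanSpace.exists_nets_card_le {d : ℕ} {T : Set (EuclideanSpace ℝ (Fin d))}
    (hT : Bornology.IsBounded T) :
    ∃ (A : ℕ → Finset T) (K R : ℕ), (∀ n s, ∃ a ∈ A n, dist s a ≤ (1 / 2 : ℝ) ^ n) ∧
      ∀ n, (A n).card ≤ K * R ^ n := by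
  classical
  obtain ⟨M₀, hM₀⟩ := hT.exists_norm_le
  obtain ⟨M, hM⟩ := exists_nat_ge M₀
  have hnorm : ∀ x : T, ∀ i, |x.1 i| ≤ M := fun x i =>
    (PiLp.norm_apply_le x.1 i).trans ((hM₀ _ x.2).trans hM)
  -- Points in one grid cell of side 2⁻ⁿ/L are within √d · 2⁻ⁿ/L ≤ 2⁻ⁿ of each other; the `+ 1`
  -- keeps L positive when d = 0.
  let L : ℕ := d + 1
  let q : ℕ → T → Fin d → ℤ := fun n x i => ⌊x.1 i * (L * 2 ^ n)⌋
  let B : ℕ → Finset (Fin d → ℤ) := fun n =>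
    Fintype.piFinset fun _ => Finset.Icc (-(M * (L * 2 ^ n) : ℕ) : ℤ) ((M * (L * 2 ^ n) : ℕ) : ℤ)
  have hq : ∀ n x, q n x ∈ B n := by
    intro n x
    simp only [B, Fintype.mem_piFinset, Finset.mem_Icc]
    intro i
    have h := abs_le.1 (hnorm x i)
    have hp : (0 : ℝ) < L * 2 ^ n := by positivity
    constructor
    · apply Int.le_floor.2
      push_cast
      nlinarith [h.1]
    · have h1 : ((q n x i : ℤ) : ℝ) ≤ x.1 i * (L * 2 ^ n) := Int.floor_le _
      have h2 : x.1 i * (L * 2 ^ n) ≤ M * (L * 2 ^ n) := by nlinarith [h.2]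
      have h3 := h1.trans h2
      have h4 : ((q n x i : ℤ) : ℝ) ≤ ((M * (L * 2 ^ n) : ℕ) : ℤ) := by
        push_cast
        exact h3
      exact_mod_cast h4
  -- One point of T is chosen in each occupied cell, so the nets lie in T itself.
  let A : ℕ → Finset T := fun n => (Finset.univ : Finset (B n)).biUnion fun c =>
    if h : ∃ x, q n x = c.1 then {h.choose} else ∅
  refine ⟨A, (2 * (M * L) + 1) ^ d, 2 ^ d, fun n s => ?_, fun n => ?_⟩
  · have h : ∃ x, q n x = q n s := ⟨s, rfl⟩
    refine ⟨h.choose, ?_, ?_⟩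
    · simp only [A, Finset.mem_biUnion]
      refine ⟨⟨q n s, hq n s⟩, Finset.mem_univ _, ?_⟩
      rw [dif_pos h]
      simp
    · have hs := h.choose_spec
      generalize h.choose = y at hs
      have hi : ∀ i, |s.1 i - y.1 i| ≤ (1 / 2 : ℝ) ^ n / L := by
        intro i
        have h1 := Int.abs_sub_lt_one_of_floor_eq_floor (congrFun hs i).symm
        rw [← sub_mul, abs_mul, abs_of_pos (by positivity : (0 : ℝ) < L * 2 ^ n)] at h1
        rw [one_div, inv_pow, le_div_iff₀ (by positivity), ← one_div, le_div_iff₀ (by positivity),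
          mul_assoc]
        exact h1.le
      rw [Subtype.dist_eq, EuclideanSpace.dist_eq]
      refine (Real.sqrt_le_sqrt (Finset.sum_le_sum fun i _ =>
        pow_le_pow_left₀ dist_nonneg (hi i) 2)).trans ?_
      rw [Finset.sum_const, Finset.card_univ, Fintype.card_fin]
      apply Real.sqrt_le_iff.2
      refine ⟨by positivity, ?_⟩
      rw [div_pow, nsmul_eq_mul, ← mul_div_assoc, div_le_iff₀ (by positivity), mul_comm]
      gcongr
      simp only [L]
      push_cast
      nlinarith [(Nat.cast_nonneg d : (0 : ℝ) ≤ d)]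
  · have h1 : (A n).card ≤ (B n).card := by
      refine Finset.card_biUnion_le.trans ((Finset.sum_le_card_nsmul _ _ 1 fun c _ => ?_).trans ?_)
      · split_ifs <;> simp
      · simp
    refine h1.trans ?_
    simp only [B, Fintype.card_piFinset, Int.card_Icc, Finset.prod_const, Finset.card_univ,
      Fintype.card_fin]
    rw [← pow_mul, mul_comm d n, pow_mul, ← mul_pow]
    gcongr
    have h2 : 1 ≤ 2 ^ n := Nat.one_le_two_pow
    have : (((M * (L * 2 ^ n) : ℕ) : ℤ) + 1 - -((M * (L * 2 ^ n) : ℕ) : ℤ)).toNat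
        = 2 * (M * L) * 2 ^ n + 1 := by
      rw [sub_neg_eq_add]
      have : (((M * (L * 2 ^ n) : ℕ) : ℤ) + 1 + ((M * (L * 2 ^ n) : ℕ) : ℤ))
        = ((2 * (M * L) * 2 ^ n + 1 : ℕ) : ℤ) := by push_cast; ring
      rw [this, Int.toNat_natCast]
    rw [this, add_mul, one_mul]
    omega

/-! ### Deterministic chaining and compactness in C(X) -/

section Chaining

variable {X : Type*} [PseudoMetricSpace X] [DecidableEq X] {A : ℕ → Finset X} {h : X → ℝ}
  {ρ : ℝ} {n₀ : ℕ}

/-- Chaining: if a continuous function has geometrically small increments between close points of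
successive nets, then its distance to the values on the `n`-th net is geometrically small. -/
theorem abs_sub_le_of_abs_sub_net_le (hh : Continuous h) (hρ : 0 < ρ) (hρ1 : ρ < 1)
    {π : ℕ → X → X} (hπA : ∀ n s, π n s ∈ A n) (hπ : ∀ n s, dist s (π n s) ≤ (1 / 2 : ℝ) ^ n)
    (hinc : ∀ n ≥ n₀, ∀ a ∈ A n ∪ A (n + 1), ∀ b ∈ A n ∪ A (n + 1),
      dist a b ≤ 3 * (1 / 2 : ℝ) ^ n → |h a - h b| ≤ ρ ^ n)
    {n : ℕ} (hn : n₀ ≤ n) (s : X) : |h s - h (π n s)| ≤ ρ ^ n / (1 - ρ) := by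
  -- The right side is the partial geometric sum ρⁿ + … + ρⁿ⁺ᵏ⁻¹.
  have hstep : ∀ k, |h (π n s) - h (π (n + k) s)| ≤ (1 - ρ ^ k) * (ρ ^ n / (1 - ρ)) := by
    intro k
    induction k with
    | zero => simp
    | succ k ih =>
      have h1 := hinc (n + k) (by omega) (π (n + k) s) (Finset.mem_union_left _ (hπA _ s))
        (π (n + k + 1) s) (Finset.mem_union_right _ (hπA _ s)) (by
          have h2 := hπ (n + k) s
          have h3 := hπ (n + k + 1) s
          have h4 := dist_triangle_left (π (n + k) s) (π (n + k + 1) s) s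
          rw [pow_succ] at h3
          have : (0 : ℝ) < (1 / 2) ^ (n + k) := by positivity
          linarith)
      refine (abs_sub_le _ (h (π (n + k) s)) _).trans ((add_le_add ih h1).trans_eq ?_)
      have : 1 - ρ ≠ 0 := by linarith
      field_simp
      ring
  have hlim : Tendsto (fun k => h (π (n + k) s)) atTop (𝓝 (h s)) := by
    refine (hh.tendsto s).comp (tendsto_iff_dist_tendsto_zero.2 ?_)
    refine squeeze_zero (fun _ => dist_nonneg) (fun k => (dist_comm _ _).trans_le (hπ (n + k) s)) ?_
    have h1 := tendsto_pow_atTop_nhds_zero_of_lt_one (r := (1 / 2 : ℝ)) (by norm_num) (by norm_num)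
    refine (h1.comp (tendsto_add_atTop_nat n)).congr fun k => ?_
    rw [Function.comp_apply, add_comm]
  rw [abs_sub_comm]
  refine le_of_tendsto ((tendsto_const_nhds.sub hlim).abs) (Eventually.of_forall fun k => ?_)
  refine (hstep k).trans (mul_le_of_le_one_left ?_ ?_)
  · exact div_nonneg (by positivity) (by linarith)
  · linarith [pow_nonneg hρ.le k]

/-- Chaining: geometrically small increments between close points of successive nets give a modulus
of continuity. -/
theorem abs_sub_le_of_dist_le (hh : Continuous h) (hρ : 0 < ρ) (hρ1 : ρ < 1)
    {π : ℕ → X → X} (hπA : ∀ n s, π n s ∈ A n) (hπ : ∀ n s, dist s (π n s) ≤ (1 / 2 : ℝ) ^ n)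
    (hinc : ∀ n ≥ n₀, ∀ a ∈ A n ∪ A (n + 1), ∀ b ∈ A n ∪ A (n + 1),
      dist a b ≤ 3 * (1 / 2 : ℝ) ^ n → |h a - h b| ≤ ρ ^ n)
    {n : ℕ} (hn : n₀ ≤ n) {s t : X} (hst : dist s t ≤ (1 / 2 : ℝ) ^ n) :
    |h s - h t| ≤ (2 / (1 - ρ) + 1) * ρ ^ n := by
  have h1 := abs_sub_le_of_abs_sub_net_le hh hρ hρ1 hπA hπ hinc hn s
  have h2 := abs_sub_le_of_abs_sub_net_le hh hρ hρ1 hπA hπ hinc hn t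
  -- The factor 3 in `hinc` is what this triangle inequality needs: 2⁻ⁿ from each projection and 2⁻ⁿ
  -- between s and t.
  have h3 := hinc n hn (π n s) (Finset.mem_union_left _ (hπA _ s)) (π n t)
    (Finset.mem_union_left _ (hπA _ t)) (by
      have h4 := dist_triangle_left (π n s) (π n t) s
      have h5 := dist_triangle s t (π n t)
      linarith [hπ n s, hπ n t])
  calc |h s - h t| = |(h s - h (π n s)) + (h (π n s) - h (π n t)) + -(h t - h (π n t))| := by
        congr 1
        ring
    _ ≤ |h s - h (π n s)| + |h (π n s) - h (π n t)| + |-(h t - h (π n t))| := abs_add_three _ _ _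
    _ ≤ ρ ^ n / (1 - ρ) + ρ ^ n + ρ ^ n / (1 - ρ) := by
        rw [abs_neg]
        gcongr
    _ = _ := by ring

end Chaining

/-- Uniformly bounded real functions with a common geometric modulus of continuity form a compact
set. -/
theorem ContinuousMap.isCompact_setOf_abs_sub_le {X : Type*} [PseudoMetricSpace X] [CompactSpace X]
    {ρ D : ℝ} (hρ : 0 < ρ) (hρ1 : ρ < 1) (n₀ : ℕ) (M : ℝ) :
    IsCompact {h : C(X, ℝ) | (∀ x, |h x| ≤ M) ∧
      ∀ n ≥ n₀, ∀ s t, dist s t ≤ (1 / 2 : ℝ) ^ n → |h s - h t| ≤ D * ρ ^ n} := by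
  let e := (ContinuousMap.isometryEquivBoundedOfCompact X ℝ).toHomeomorph
  let S := {h : C(X, ℝ) | (∀ x, |h x| ≤ M) ∧
      ∀ n ≥ n₀, ∀ s t, dist s t ≤ (1 / 2 : ℝ) ^ n → |h s - h t| ≤ D * ρ ^ n}
  have hclosed : IsClosed S := by
    have hS : S = (⋂ x, {h : C(X, ℝ) | |h x| ≤ M}) ∩ ⋂ (n) (_ : n ≥ n₀) (s) (t)
        (_ : dist s t ≤ (1 / 2 : ℝ) ^ n), {h : C(X, ℝ) | |h s - h t| ≤ D * ρ ^ n} := by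
      ext h
      simp [S]
    rw [hS]
    refine (isClosed_iInter fun x => isClosed_le (by fun_prop) (by fun_prop)).inter ?_
    refine isClosed_iInter fun n => isClosed_iInter fun _ => isClosed_iInter fun s =>
      isClosed_iInter fun t => isClosed_iInter fun _ => isClosed_le (by fun_prop) (by fun_prop)
  suffices hc : IsCompact (e.symm ⁻¹' S) by
    have := hc.image e.symm.continuous
    rwa [Set.image_preimage_eq _ e.symm.surjective] at this
  refine BoundedContinuousFunction.arzela_ascoli₂ (Set.Icc (-M) M) isCompact_Icc _
    (hclosed.preimage e.symm.continuous) ?_ ?_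
  · intro f x hf
    exact abs_le.1 (hf.1 x)
  · refine fun x => Metric.equicontinuousAt_iff.2 fun ε hε => ?_
    have hlim := (tendsto_pow_atTop_nhds_zero_of_lt_one hρ.le hρ1).const_mul D
    rw [mul_zero] at hlim
    obtain ⟨n, hn, hn₀⟩ := ((hlim.eventually (gt_mem_nhds hε)).and (eventually_ge_atTop n₀)).exists
    refine ⟨(1 / 2 : ℝ) ^ n, by positivity, fun y hy f => ?_⟩
    rw [dist_comm] at hy
    exact (f.2.2 n hn₀ x y hy.le).trans_lt hn

/-! ### Gaussian tails and tightness -/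

/-- The Gaussian tail bound. -/
theorem ProbabilityTheory.HasGaussianLaw.measure_le_abs_sub {Ω : Type*} [MeasurableSpace Ω]
    {P : Measure Ω} [IsProbabilityMeasure P] {Y : Ω → ℝ} (hY : HasGaussianLaw Y P) {m V : ℝ}
    (hm : ∫ ω, Y ω ∂P = m) (hV : Var[Y; P] ≤ V) {r : ℝ} (hr : 0 ≤ r) :
    P {ω | r ≤ |Y ω - m|} ≤ ENNReal.ofReal (2 * Real.exp (-r ^ 2 / (2 * V))) := by
  have hV0 : 0 ≤ V := (variance_nonneg Y P).trans hV
  have hZ : P.map (fun ω => Y ω - m) = gaussianReal 0 Var[Y; P].toNNReal := by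
    have := (gaussianReal_sub_const (X := Y) ⟨hY.aemeasurable, hY.map_eq_gaussianReal⟩ m).map_eq
    rwa [hm, sub_self] at this
  -- Sub-Gaussianity allows an upper bound V for the variance, zero included: division by zero then
  -- makes the claimed bound 2.
  have hsub : HasSubgaussianMGF (fun ω => Y ω - m) V.toNNReal P := by
    constructor
    · intro t
      have hae : AEMeasurable (fun ω => Y ω - m) P := hY.aemeasurable.sub_const m
      have := integrable_exp_mul_gaussianReal (μ := 0) (v := Var[Y; P].toNNReal) t
      rw [← hZ] at this
      exact (integrable_map_measure (by fun_prop) hae).1 this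
    · intro t
      rw [mgf_gaussianReal hZ, zero_mul, zero_add]
      gcongr
  have h1 := hsub.measure_ge_le hr
  have h2 := hsub.neg.measure_ge_le hr
  rw [Real.coe_toNNReal _ hV0] at h1 h2
  have hsubset : {ω | r ≤ |Y ω - m|} ⊆ {ω | r ≤ Y ω - m} ∪ {ω | r ≤ (-fun ω => Y ω - m) ω} :=
    fun ω hω => by
      simpa [neg_sub] using le_abs.1 (show r ≤ |Y ω - m| from hω)
  refine (measure_mono hsubset).trans ((measure_union_le _ _).trans ?_)
  rw [two_mul, ENNReal.ofReal_add (by positivity) (by positivity)]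
  refine add_le_add ?_ ?_
  · rw [← ofReal_measureReal]
    exact ENNReal.ofReal_le_ofReal h1
  · rw [← ofReal_measureReal]
    exact ENNReal.ofReal_le_ofReal h2

/-- Consecutive terms have ratio R · exp(-κ(τ-1)τⁿ) → 0. This is how Gaussian tails beat the
exponential growth of the nets. -/
theorem summable_pow_mul_exp_neg_mul_pow {R κ τ : ℝ} (hR : 0 < R) (hκ : 0 < κ) (hτ : 1 < τ) :
    Summable fun n : ℕ => R ^ n * Real.exp (-(κ * τ ^ n)) := by
  refine summable_of_ratio_test_tendsto_lt_one (l := 0) one_pos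
    (Eventually.of_forall fun n => by positivity) ?_
  have h1 : Tendsto (fun n : ℕ => κ * (τ - 1) * τ ^ n) atTop atTop :=
    (tendsto_pow_atTop_atTop_of_one_lt hτ).const_mul_atTop (mul_pos hκ (by linarith))
  have h2 := (Real.tendsto_exp_neg_atTop_nhds_zero.comp h1).const_mul R
  rw [mul_zero] at h2
  refine h2.congr fun n => ?_
  rw [Real.norm_of_nonneg (by positivity), Real.norm_of_nonneg (by positivity), eq_div_iff
    (by positivity), Function.comp_apply, mul_mul_mul_comm, ← pow_succ', ← Real.exp_add]
  congr 2
  ring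

namespace IsContGaussianLaw

variable {X : Type*} [TopologicalSpace X] {P : ProbabilityMeasure C(X, ℝ)} {m : X → ℝ}
  {c : X → X → ℝ}

theorem memLp_two (h : IsContGaussianLaw P m c) (x : X) :
    MemLp (fun f : C(X, ℝ) => f x) 2 (P : Measure C(X, ℝ)) :=
  ((IsContGaussianLaw.isGaussianProcess h).hasGaussianLaw_eval x).memLp_two

theorem variance_eval (h : IsContGaussianLaw P m c) (x : X) :
    Var[fun f : C(X, ℝ) => f x; P] = c x x := by
  rw [← h.cov_eq, covariance_self (h.memLp_two x).aemeasurable]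

theorem variance_eval_sub (h : IsContGaussianLaw P m c) (x y : X) :
    Var[fun f : C(X, ℝ) => f x - f y; P] = c x x - 2 * c x y + c y y := by
  rw [variance_fun_sub (h.memLp_two x) (h.memLp_two y), h.variance_eval, h.variance_eval, h.cov_eq]

theorem measure_le_abs_eval_sub (h : IsContGaussianLaw P m c) {x : X} {V : ℝ} (hV : c x x ≤ V)
    {r : ℝ} (hr : 0 ≤ r) : (P : Measure C(X, ℝ)) {f | r ≤ |f x - m x|} ≤
      ENNReal.ofReal (2 * Real.exp (-r ^ 2 / (2 * V))) :=
  ((IsContGaussianLaw.isGaussianProcess h).hasGaussianLaw_eval x).measure_le_abs_sub (h.mean_eq x)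
    (h.variance_eval x ▸ hV) hr

theorem measure_le_abs_eval_sub_eval_sub (h : IsContGaussianLaw P m c) {x y : X} {V : ℝ}
    (hV : c x x - 2 * c x y + c y y ≤ V) {r : ℝ} (hr : 0 ≤ r) :
    (P : Measure C(X, ℝ)) {f | r ≤ |f x - f y - (m x - m y)|} ≤
      ENNReal.ofReal (2 * Real.exp (-r ^ 2 / (2 * V))) := by
  refine ((IsContGaussianLaw.isGaussianProcess h).hasGaussianLaw_fun_sub (s := x)
    (t := y)).measure_le_abs_sub ?_
    (h.variance_eval_sub x y ▸ hV) hr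
  rw [integral_sub ((h.memLp_two x).integrable one_le_two) ((h.memLp_two y).integrable one_le_two),
    h.mean_eq, h.mean_eq]

end IsContGaussianLaw

/-- Chaining for Gaussian laws: the probability of a large increment between close points of the
nets of high level is uniformly small. -/
theorem exists_measure_increments_le {X : Type*} [PseudoMetricSpace X] [DecidableEq X]
    {A : ℕ → Finset X} {K R : ℕ} (hA : ∀ n, (A n).card ≤ K * R ^ n) {C γ : ℝ} (hC : 0 < C)
    (hγ : 0 < γ) {ε : ENNReal} (hε : 0 < ε) :
    ∃ n₀ : ℕ, ∀ (P : ProbabilityMeasure C(X, ℝ)) (m : X → ℝ) (c : X → X → ℝ),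
      IsContGaussianLaw P m c → (∀ x y, c x x - 2 * c x y + c y y ≤ C * dist x y ^ γ) →
      (P : Measure C(X, ℝ)) {f | ∃ n ≥ n₀, ∃ a ∈ A n ∪ A (n + 1), ∃ b ∈ A n ∪ A (n + 1),
        dist a b ≤ 3 * (1 / 2 : ℝ) ^ n ∧
          ((1 / 2 : ℝ) ^ (γ / 4)) ^ n < |f a - f b - (m a - m b)|} ≤ ε := by
  -- At distance at most 3 · 2⁻ⁿ the increment variance is at most C · 3^γ · ρ⁴ⁿ. With threshold ρⁿ
  -- the tail exponent is κρ⁻²ⁿ, which grows geometrically.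
  set ρ : ℝ := (1 / 2 : ℝ) ^ (γ / 4) with hρdef
  have hρ : 0 < ρ := by positivity
  have hρ1 : ρ < 1 := Real.rpow_lt_one (by norm_num) (by norm_num) (by positivity)
  have hρ4 : (1 / 2 : ℝ) ^ γ = ρ ^ 4 := by
    rw [hρdef, ← Real.rpow_natCast, ← Real.rpow_mul (by norm_num)]
    congr 1
    push_cast
    ring
  set κ : ℝ := 1 / (2 * C * 3 ^ γ) with hκdef
  have hκ : 0 < κ := by positivity
  have hτ : 1 < (ρ ^ 2)⁻¹ := (one_lt_inv₀ (by positivity)).2 (pow_lt_one₀ hρ.le hρ1 (by norm_num))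
  let N : ℕ → Finset X := fun n => A n ∪ A (n + 1)
  -- The base R + 1 ≥ 1 makes the bound monotone in n, so that level n + 1 dominates level n even if
  -- R = 0.
  have hN : ∀ n, ((N n).card : ℝ) ≤ 2 * K * (R + 1) * ((R : ℝ) + 1) ^ n := by
    intro n
    have h1 : ∀ n, ((A n).card : ℝ) ≤ K * ((R : ℝ) + 1) ^ n := fun n => by
      refine (Nat.cast_le.2 (hA n)).trans ?_
      push_cast
      gcongr
      linarith
    have h2 : ((N n).card : ℝ) ≤ (A n).card + (A (n + 1)).card := by
      exact_mod_cast Finset.card_union_le _ _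
    have h3 : (K : ℝ) * (R + 1) ^ n ≤ K * ((R : ℝ) + 1) ^ (n + 1) := by
      gcongr
      · linarith [(Nat.cast_nonneg R : (0 : ℝ) ≤ R)]
      · omega
    have h4 := h1 (n + 1)
    have h5 := h1 n
    rw [pow_succ] at h3 h4
    linarith
  -- Union bound at level n: the number of pairs times the tail of one increment.
  let u : ℕ → ℝ := fun n => (2 * K * (R + 1) * ((R : ℝ) + 1) ^ n) ^ 2 *
    (2 * Real.exp (-(κ * (ρ ^ 2)⁻¹ ^ n)))
  have hu : Summable u := by
    refine ((summable_pow_mul_exp_neg_mul_pow (R := ((R : ℝ) + 1) ^ 2) (by positivity) hκ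
      hτ).mul_left (2 * (2 * K * ((R : ℝ) + 1)) ^ 2)).congr fun n => ?_
    simp only [u]
    rw [← pow_mul]
    ring
  obtain ⟨n₀, hn₀⟩ : ∃ n₀, ENNReal.ofReal (∑' k, u (k + n₀)) ≤ ε := by
    have h1 := (ENNReal.continuous_ofReal.tendsto 0).comp (tendsto_sum_nat_add u)
    rw [ENNReal.ofReal_zero] at h1
    obtain ⟨n₀, hn₀⟩ := (h1.eventually (gt_mem_nhds hε)).exists
    exact ⟨n₀, hn₀.le⟩
  refine ⟨n₀, fun P m c hP hc => ?_⟩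
  have hpair : ∀ n a b, (P : Measure C(X, ℝ)) {f | dist a b ≤ 3 * (1 / 2 : ℝ) ^ n ∧
      ρ ^ n < |f a - f b - (m a - m b)|} ≤
      ENNReal.ofReal (2 * Real.exp (-(κ * (ρ ^ 2)⁻¹ ^ n))) := by
    intro n a b
    by_cases hab : dist a b ≤ 3 * (1 / 2 : ℝ) ^ n
    · have hV : c a a - 2 * c a b + c b b ≤ C * (3 ^ γ * (ρ ^ 4) ^ n) := by
        refine (hc a b).trans ?_
        gcongr
        refine (Real.rpow_le_rpow dist_nonneg hab hγ.le).trans_eq ?_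
        rw [Real.mul_rpow (by norm_num) (by positivity), ← hρ4, ← Real.rpow_natCast,
          ← Real.rpow_mul (by norm_num), ← Real.rpow_mul_natCast (by norm_num), mul_comm γ]
      refine (measure_mono fun f hf => hf.2.le).trans
        ((hP.measure_le_abs_eval_sub_eval_sub hV (pow_nonneg hρ.le n)).trans_eq ?_)
      congr 3
      have h4 : (ρ ^ 4) ^ n = (ρ ^ n) ^ 2 * (ρ ^ 2) ^ n := by ring
      rw [hκdef, h4, inv_pow]
      field_simp
    · simp only [hab, false_and, Set.ofPred_false, measure_empty, zero_le]
  have hsub : {f : C(X, ℝ) | ∃ n ≥ n₀, ∃ a ∈ A n ∪ A (n + 1), ∃ b ∈ A n ∪ A (n + 1),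
      dist a b ≤ 3 * (1 / 2 : ℝ) ^ n ∧ ρ ^ n < |f a - f b - (m a - m b)|} ⊆
      ⋃ k, ⋃ a ∈ N (k + n₀), ⋃ b ∈ N (k + n₀), {f | dist a b ≤ 3 * (1 / 2 : ℝ) ^ (k + n₀) ∧
      ρ ^ (k + n₀) < |f a - f b - (m a - m b)|} := by
    rintro f ⟨n, hn, a, ha, b, hb, h⟩
    obtain ⟨k, rfl⟩ := Nat.exists_eq_add_of_le' hn
    simp only [Set.mem_iUnion]
    exact ⟨k, a, ha, b, hb, h⟩
  refine ((measure_mono hsub).trans (measure_iUnion_le _)).trans (le_trans ?_ hn₀)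
  rw [ENNReal.ofReal_tsum_of_nonneg (fun k => by positivity) ((summable_nat_add_iff n₀).2 hu)]
  refine ENNReal.tsum_le_tsum fun k => ?_
  have h1 : ∀ a ∈ N (k + n₀), (P : Measure C(X, ℝ)) (⋃ b ∈ N (k + n₀),
      {f | dist a b ≤ 3 * (1 / 2 : ℝ) ^ (k + n₀) ∧ ρ ^ (k + n₀) < |f a - f b - (m a - m b)|}) ≤
      (N (k + n₀)).card • ENNReal.ofReal (2 * Real.exp (-(κ * (ρ ^ 2)⁻¹ ^ (k + n₀)))) := fun a _ =>
    (measure_biUnion_finset_le _ _).trans (Finset.sum_le_card_nsmul _ _ _ fun b _ => hpair _ a b)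
  refine (measure_biUnion_finset_le _ _).trans ((Finset.sum_le_card_nsmul _ _ _ h1).trans ?_)
  rw [smul_smul, ← ENNReal.ofReal_nsmul]
  refine ENNReal.ofReal_le_ofReal ?_
  rw [nsmul_eq_mul, Nat.cast_mul, ← sq]
  simp only [u]
  gcongr
  exact hN _

open scoped Pointwise in
/-- A family of Gaussian laws on `C(X, ℝ)` is tight if the space has nets of exponential size, the
variances of the increments are uniformly Hölder, the variances are bounded and the means stay in a
compact set. -/
theorem isTightMeasureSet_of_isContGaussianLaw {X : Type*} [PseudoMetricSpace X] [CompactSpace X]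
    {A : ℕ → Finset X} {K R : ℕ} (hAnet : ∀ n s, ∃ a ∈ A n, dist s a ≤ (1 / 2 : ℝ) ^ n)
    (hA : ∀ n, (A n).card ≤ K * R ^ n) {C γ B : ℝ} (hC : 0 < C) (hγ : 0 < γ)
    {ι : Type*} {P : ι → ProbabilityMeasure C(X, ℝ)} {m : ι → C(X, ℝ)} {c : ι → X → X → ℝ}
    (hP : ∀ i, IsContGaussianLaw (P i) (m i) (c i))
    (hc : ∀ i x y, c i x x - 2 * c i x y + c i y y ≤ C * dist x y ^ γ) (hB : ∀ i x, c i x x ≤ B)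
    {S : Set C(X, ℝ)} (hS : IsCompact S) (hm : ∀ i, m i ∈ S) :
    IsTightMeasureSet (Set.range fun i => (P i : Measure C(X, ℝ))) := by
  classical
  rw [isTightMeasureSet_iff_exists_isCompact_measure_compl_le]
  intro ε hε
  choose π hπA hπ using hAnet
  set ρ : ℝ := (1 / 2 : ℝ) ^ (γ / 4) with hρdef
  have hρ : 0 < ρ := by positivity
  have hρ1 : ρ < 1 := Real.rpow_lt_one (by norm_num) (by norm_num) (by positivity)
  have hε2 : 0 < ε / 2 := ENNReal.half_pos hε.ne'
  obtain ⟨n₀, hn₀⟩ := exists_measure_increments_le hA hC hγ hε2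
  -- A positive variance bound is needed for the tail to vanish as M → ∞.
  set B' : ℝ := max B 1
  have hB' : 0 < B' := lt_max_of_lt_right one_pos
  obtain ⟨M, hM0, hM⟩ : ∃ M : ℝ, 0 ≤ M ∧
      (A n₀).card • ENNReal.ofReal (2 * Real.exp (-M ^ 2 / (2 * B'))) ≤ ε / 2 := by
    have h1 : Tendsto (fun M : ℝ => M ^ 2 / (2 * B')) atTop atTop :=
      (tendsto_pow_atTop two_ne_zero).atTop_div_const (by positivity)
    have h2 := ((Real.tendsto_exp_neg_atTop_nhds_zero.comp h1).const_mul 2).const_mul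
      ((A n₀).card : ℝ)
    rw [mul_zero, mul_zero] at h2
    have h3 := (ENNReal.continuous_ofReal.tendsto 0).comp h2
    rw [ENNReal.ofReal_zero] at h3
    obtain ⟨M, hM, hM0⟩ := ((h3.eventually (gt_mem_nhds hε2)).and (eventually_ge_atTop 0)).exists
    refine ⟨M, hM0, le_of_eq_of_le ?_ hM.le⟩
    rw [← ENNReal.ofReal_nsmul, nsmul_eq_mul]
    simp [neg_div]
  -- This compact set is meant for the centred path f - m; adding the compact set of means gives the
  -- one for f. A centred path leaves it only if some chaining increment is large or some value on
  -- the net of level n₀ is.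
  let K₀ : Set C(X, ℝ) := {h | (∀ x, |h x| ≤ M + ρ ^ n₀ / (1 - ρ)) ∧
      ∀ n ≥ n₀, ∀ s t, dist s t ≤ (1 / 2 : ℝ) ^ n → |h s - h t| ≤ (2 / (1 - ρ) + 1) * ρ ^ n}
  have hK₀ : IsCompact K₀ := ContinuousMap.isCompact_setOf_abs_sub_le hρ hρ1 n₀ _
  refine ⟨K₀ + S, hK₀.add hS, ?_⟩
  rintro _ ⟨i, rfl⟩
  have hsub : (K₀ + S)ᶜ ⊆ {f : C(X, ℝ) | ∃ n ≥ n₀, ∃ a ∈ A n ∪ A (n + 1), ∃ b ∈ A n ∪ A (n + 1),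
      dist a b ≤ 3 * (1 / 2 : ℝ) ^ n ∧ ρ ^ n < |f a - f b - (m i a - m i b)|} ∪
      ⋃ a ∈ A n₀, {f : C(X, ℝ) | M ≤ |f a - m i a|} := by
    intro f hf
    by_contra hcon
    rw [Set.mem_union, not_or] at hcon
    obtain ⟨h1, h2⟩ := hcon
    simp only [Set.mem_ofPred_eq, not_exists, not_and, not_lt] at h1
    simp only [Set.mem_iUnion, Set.mem_ofPred_eq, not_exists, not_le] at h2
    refine hf ⟨f - m i, ?_, m i, hm i, sub_add_cancel _ _⟩
    have hinc : ∀ n ≥ n₀, ∀ a ∈ A n ∪ A (n + 1), ∀ b ∈ A n ∪ A (n + 1),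
        dist a b ≤ 3 * (1 / 2 : ℝ) ^ n → |(f - m i) a - (f - m i) b| ≤ ρ ^ n := by
      intro n hn a ha b hb hab
      refine (congrArg abs ?_).trans_le (h1 n hn a ha b hb hab)
      simp only [ContinuousMap.sub_apply]
      ring
    constructor
    · intro x
      have h3 := abs_sub_le_of_abs_sub_net_le (f - m i).continuous hρ hρ1 hπA hπ hinc le_rfl x
      have h4 := (h2 (π n₀ x) (hπA n₀ x)).le
      have h5 := abs_sub_abs_le_abs_sub ((f - m i) x) ((f - m i) (π n₀ x))
      simp only [ContinuousMap.sub_apply] at h3 h5 ⊢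
      linarith
    · intro n hn s t hst
      exact abs_sub_le_of_dist_le (f - m i).continuous hρ hρ1 hπA hπ hinc hn hst
  refine (measure_mono hsub).trans ((measure_union_le _ _).trans ?_)
  rw [← ENNReal.add_halves ε]
  refine add_le_add (hn₀ (P i) (m i) (c i) (hP i) (hc i)) ?_
  refine (measure_biUnion_finset_le _ _).trans ((Finset.sum_le_card_nsmul _ _ _ fun a _ => ?_).trans
    hM)
  exact (hP i).measure_le_abs_eval_sub ((hB i a).trans (le_max_left _ _)) hM0

-- Characteristic functions and identification of limits

universe u

/-- The finite-dimensional characteristic functions of `P` are those of a Gaussian process with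
mean `m` and covariance `c`. -/
def HasGaussianCharFun {X : Type u} [TopologicalSpace X] (P : ProbabilityMeasure C(X, ℝ))
    (m : X → ℝ) (c : X → X → ℝ) : Prop :=
  ∀ (ι : Type u) [Fintype ι] (x : ι → X) (θ : ι → ℝ),
    ∫ f : C(X, ℝ), Complex.exp ((∑ i, θ i * f (x i) : ℝ) * Complex.I) ∂(P : Measure C(X, ℝ)) =
      Complex.exp ((∑ i, θ i * m (x i) : ℝ) * Complex.I -
        (∑ i, ∑ j, θ i * θ j * c (x i) (x j) : ℝ) / 2)

section

variable {X : Type u} [TopologicalSpace X] {P : ProbabilityMeasure C(X, ℝ)} {m : X → ℝ}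
  {c : X → X → ℝ}

theorem IsContGaussianLaw.hasGaussianCharFun (h : IsContGaussianLaw P m c) :
    HasGaussianCharFun P m c := by
  intro ι _ x θ
  have hY : HasGaussianLaw (fun f : C(X, ℝ) => ∑ i, θ i * f (x i)) (P : Measure C(X, ℝ)) :=
    (((IsContGaussianLaw.isGaussianProcess h).comp_right x).comp_left
      (fun i => θ i • ContinuousLinearMap.id ℝ ℝ)).hasGaussianLaw_fun_sum (I := Finset.univ)
  have hL : ∀ i, MemLp (fun f : C(X, ℝ) => θ i * f (x i)) 2 (P : Measure C(X, ℝ)) :=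
    fun i => (h.memLp_two (x i)).const_mul (θ i)
  have hmean : ∫ f : C(X, ℝ), ∑ i, θ i * f (x i) ∂(P : Measure C(X, ℝ)) = ∑ i, θ i * m (x i) := by
    rw [integral_finsetSum _ fun i _ => (hL i).integrable one_le_two]
    simp_rw [integral_const_mul, h.mean_eq]
  have hvar : Var[fun f : C(X, ℝ) => ∑ i, θ i * f (x i); (P : Measure C(X, ℝ))] =
      ∑ i, ∑ j, θ i * θ j * c (x i) (x j) := by
    rw [variance_fun_sum hL]
    simp_rw [covariance_const_mul_left, covariance_const_mul_right, h.cov_eq, mul_assoc]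
  have h1 := charFun_gaussianReal (μ := ∑ i, θ i * m (x i))
    (v := (∑ i, ∑ j, θ i * θ j * c (x i) (x j)).toNNReal) 1
  rw [← hmean, ← hvar, ← hY.map_eq_gaussianReal, charFun_apply_real, integral_map hY.aemeasurable
    (by fun_prop), Real.coe_toNNReal _ (variance_nonneg _ _), hmean, hvar] at h1
  simpa using h1

theorem charFun_map_eval {ι : Type*} [Fintype ι] (x : ι → X) (θ : EuclideanSpace ℝ ι) :
    charFun ((P : Measure C(X, ℝ)).map fun f => WithLp.toLp 2 fun i => f (x i)) θ =
      ∫ f : C(X, ℝ), Complex.exp ((∑ i, θ i * f (x i) : ℝ) * Complex.I) ∂(P : Measure C(X, ℝ)) := by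
  rw [charFun_apply, integral_map (Continuous.measurable (by fun_prop)).aemeasurable (by fun_prop)]
  simp [PiLp.inner_apply]

theorem HasGaussianCharFun.map_eval_eq (h : HasGaussianCharFun P m c)
    (hc : (Matrix.of c).PosSemidef)
    {ι : Type u} [Fintype ι] [DecidableEq ι] (x : ι → X) :
    ((P : Measure C(X, ℝ)).map fun f => WithLp.toLp 2 fun i => f (x i)) =
      multivariateGaussian (WithLp.toLp 2 fun i => m (x i))
        (Matrix.of fun i j => c (x i) (x j)) := by
  have : IsProbabilityMeasure ((P : Measure C(X, ℝ)).map fun f =>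
      (WithLp.toLp 2 fun i => f (x i) : EuclideanSpace ℝ ι)) :=
    Measure.isProbabilityMeasure_map (Continuous.measurable (by fun_prop)).aemeasurable
  refine Measure.ext_of_charFun (funext fun θ => ?_)
  have hcx : (Matrix.of fun i j => c (x i) (x j)).PosSemidef := hc.submatrix x
  rw [charFun_map_eval, h, charFun_multivariateGaussian hcx]
  simp [PiLp.inner_apply, dotProduct, Matrix.mulVec, Finset.mul_sum, mul_left_comm,
    mul_comm]

/-- Characteristic functions survive weak limits whereas moments need not, so limits are identified
there; this converts back, reading mean and covariance off the multivariate Gaussian marginals. -/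
theorem HasGaussianCharFun.isContGaussianLaw (h : HasGaussianCharFun P m c)
    (hc : (Matrix.of c).PosSemidef) : IsContGaussianLaw P m c := by
  classical
  have hlaw : ∀ {ι : Type u} [Fintype ι] [DecidableEq ι] (x : ι → X), HasLaw
      (fun f : C(X, ℝ) => (WithLp.toLp 2 fun i => f (x i) : EuclideanSpace ℝ ι))
      (multivariateGaussian (WithLp.toLp 2 fun i => m (x i)) (Matrix.of fun i j => c (x i) (x j)))
      (P : Measure C(X, ℝ)) :=
    fun x => ⟨(Continuous.measurable (by fun_prop)).aemeasurable, h.map_eval_eq hc x⟩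
  refine ⟨⟨fun I => ?_⟩, fun x => ?_, fun x y => ?_⟩
  · have h1 : HasGaussianLaw (fun f : C(X, ℝ) =>
        (WithLp.toLp 2 fun i : I => f i : EuclideanSpace ℝ I)) (P : Measure C(X, ℝ)) :=
      (hlaw (fun i : I => (i : X))).hasGaussianLaw
    exact h1.map (PiLp.continuousLinearEquiv 2 ℝ fun _ : I => ℝ).toContinuousLinearMap
  -- Index types must lie in `Type u`, hence the lifted one-point type here and the lifted two-point
  -- type below.
  · have h1 := (hlaw (fun _ : PUnit.{u + 1} => x)).integral_comp (f := fun z => z PUnit.unit)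
      (by fun_prop)
    refine h1.trans ?_
    have h2 := (EuclideanSpace.proj (𝕜 := ℝ) (PUnit.unit : PUnit.{u + 1})).integral_comp_comm
      (IsGaussian.integrable_id (μ := multivariateGaussian
        (WithLp.toLp 2 fun _ : PUnit.{u + 1} => m x) (Matrix.of fun _ _ => c x x)))
    refine h2.trans ?_
    simp
  · have h1 := (hlaw (fun i : ULift.{u} Bool => cond i.down x y)).covariance_fun_comp
      (f := fun z => z ⟨true⟩) (g := fun z => z ⟨false⟩) (by fun_prop) (by fun_prop)
    refine h1.trans ?_
    have hcx : (Matrix.of fun i j : ULift.{u} Bool =>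
      c (cond i.down x y) (cond j.down x y)).PosSemidef := hc.submatrix _
    rw [covariance_eval_multivariateGaussian hcx]
    rfl

end

/-- A law on `C(X, ℝ)` is determined by its finite-dimensional characteristic functions. -/
theorem HasGaussianCharFun.eq {X : Type u} [MetricSpace X] [CompactSpace X]
    {P Q : ProbabilityMeasure C(X, ℝ)} {m : X → ℝ} {c : X → X → ℝ}
    (hP : HasGaussianCharFun P m c) (hQ : HasGaussianCharFun Q m c) : P = Q := by
  obtain ⟨S, hS, hSd⟩ := TopologicalSpace.exists_countable_dense X
  have : Countable S := hS
  let e : C(X, ℝ) → S → ℝ := fun f s => f s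
  -- Continuous functions are determined on a dense set, so `e` is injective; a continuous injection
  -- of Polish spaces is a measurable embedding.
  have hec : Continuous e := by fun_prop
  have he : MeasurableEmbedding e := hec.measurableEmbedding fun f g hfg =>
    ContinuousMap.ext fun x => congrFun (f.continuous.ext_on hSd g.continuous
      fun s hs => congrFun hfg ⟨s, hs⟩) x
  have hfd : ∀ I : Finset S, ((P : Measure C(X, ℝ)).map e).map I.restrict =
      ((Q : Measure C(X, ℝ)).map e).map I.restrict := by
    intro I
    rw [Measure.map_map (Finset.measurable_restrict I) hec.measurable,
      Measure.map_map (Finset.measurable_restrict I) hec.measurable]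
    have h1 : ((P : Measure C(X, ℝ)).map fun f => (WithLp.toLp 2 fun i : I => f (i : S) :
        EuclideanSpace ℝ I)) = (Q : Measure C(X, ℝ)).map fun f =>
        WithLp.toLp 2 fun i : I => f (i : S) := by
      have (P : ProbabilityMeasure C(X, ℝ)) : IsProbabilityMeasure ((P : Measure C(X, ℝ)).map
          fun f => (WithLp.toLp 2 fun i : I => f (i : S) : EuclideanSpace ℝ I)) :=
        Measure.isProbabilityMeasure_map (Continuous.measurable (by fun_prop)).aemeasurable
      refine Measure.ext_of_charFun (funext fun θ => ?_)
      rw [charFun_map_eval, charFun_map_eval, hP, hQ]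
    have h2 := congrArg (Measure.map (fun z : EuclideanSpace ℝ I => z.ofLp)) h1
    rwa [Measure.map_map (by fun_prop) (Continuous.measurable (by fun_prop)),
      Measure.map_map (by fun_prop) (Continuous.measurable (by fun_prop))] at h2
  have hmap : (P : Measure C(X, ℝ)).map e = (Q : Measure C(X, ℝ)).map e :=
    IsProjectiveLimit.unique (P := fun I => ((P : Measure C(X, ℝ)).map e).map I.restrict)
      (fun I => rfl) (fun I => (hfd I).symm)
  exact Subtype.ext (((he.comap_map _).symm.trans (congrArg _ hmap)).trans (he.comap_map _))

/-- Cluster points of laws with Gaussian characteristic functions whose means and covariances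
converge pointwise. -/
theorem HasGaussianCharFun.of_mapClusterPt {X : Type u} [TopologicalSpace X]
    {P : ℕ → ProbabilityMeasure C(X, ℝ)} {m : ℕ → X → ℝ} {c : ℕ → X → X → ℝ}
    (h : ∀ n, HasGaussianCharFun (P n) (m n) (c n)) {m' : X → ℝ} {c' : X → X → ℝ}
    (hm : ∀ x, Tendsto (fun n => m n x) atTop (𝓝 (m' x)))
    (hc : ∀ x y, Tendsto (fun n => c n x y) atTop (𝓝 (c' x y)))
    {Q : ProbabilityMeasure C(X, ℝ)} (hQ : MapClusterPt Q atTop P) :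
    HasGaussianCharFun Q m' c' := by
  intro ι _ x θ
  let F : BoundedContinuousFunction C(X, ℝ) ℂ := BoundedContinuousFunction.ofNormedAddCommGroup
    (fun f => Complex.exp ((∑ i, θ i * f (x i) : ℝ) * Complex.I)) (by fun_prop) 1
    fun f => (Complex.norm_exp_ofReal_mul_I _).le
  have hF : Continuous fun P : ProbabilityMeasure C(X, ℝ) => ∫ f, F f ∂(P : Measure C(X, ℝ)) :=
    continuous_iff_continuousAt.2 fun P =>
    (ProbabilityMeasure.tendsto_iff_forall_integral_rclike_tendsto ℂ).1 tendsto_id F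
  have h1 : MapClusterPt (∫ f, F f ∂(Q : Measure C(X, ℝ))) atTop
      fun n => ∫ f, F f ∂(P n : Measure C(X, ℝ)) :=
    hQ.continuousAt_comp hF.continuousAt
  have h2 : Tendsto (fun n => ∫ f, F f ∂(P n : Measure C(X, ℝ))) atTop
      (𝓝 (Complex.exp ((∑ i, θ i * m' (x i) : ℝ) * Complex.I -
        (∑ i, ∑ j, θ i * θ j * c' (x i) (x j) : ℝ) / 2))) := by
    have h3 : ∀ n, ∫ f, F f ∂(P n : Measure C(X, ℝ)) = _ := fun n => h n ι x θ
    simp_rw [h3]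
    refine (Complex.continuous_exp.tendsto _).comp (Tendsto.sub ?_ ?_)
    · exact ((Complex.continuous_ofReal.tendsto _).comp
        (tendsto_finsetSum _ fun i _ => (hm _).const_mul _)).mul_const _
    · exact ((Complex.continuous_ofReal.tendsto _).comp (tendsto_finsetSum _ fun i _ =>
        tendsto_finsetSum _ fun j _ => (hc _ _).const_mul _)).div_const _
  exact @eq_of_nhds_neBot _ _ _ _ _ (ClusterPt.mono h1 h2)

/-- Prokhorov's theorem puts the sequence in a compact set, and every cluster point has the
characteristic functions of Q, hence is Q. -/
theorem HasGaussianCharFun.tendsto {X : Type u} [MetricSpace X] [CompactSpace X]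
    {P : ℕ → ProbabilityMeasure C(X, ℝ)} {m : ℕ → X → ℝ} {c : ℕ → X → X → ℝ}
    (h : ∀ n, HasGaussianCharFun (P n) (m n) (c n))
    (htight : IsTightMeasureSet (Set.range fun n => (P n : Measure C(X, ℝ)))) {m' : X → ℝ}
    {c' : X → X → ℝ} (hm : ∀ x, Tendsto (fun n => m n x) atTop (𝓝 (m' x)))
    (hc : ∀ x y, Tendsto (fun n => c n x y) atTop (𝓝 (c' x y)))
    {Q : ProbabilityMeasure C(X, ℝ)} (hQ : HasGaussianCharFun Q m' c') :
    Tendsto P atTop (𝓝 Q) := by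
  have hcomp : IsCompact (closure (Set.range P)) := isCompact_closure_of_isTightMeasureSet <| by
    refine htight.subset ?_
    rintro _ ⟨_, ⟨n, rfl⟩, rfl⟩
    exact ⟨n, rfl⟩
  exact hcomp.tendsto_nhds_of_unique_mapClusterPt
    (Eventually.of_forall fun n => subset_closure ⟨n, rfl⟩)
    fun R _ hR => (HasGaussianCharFun.of_mapClusterPt h hm hc hR).eq hQ

theorem HasGaussianCharFun.exists_of_tight {X : Type u} [MetricSpace X] [CompactSpace X]
    {P : ℕ → ProbabilityMeasure C(X, ℝ)} {m : ℕ → X → ℝ} {c : ℕ → X → X → ℝ}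
    (h : ∀ n, HasGaussianCharFun (P n) (m n) (c n))
    (htight : IsTightMeasureSet (Set.range fun n => (P n : Measure C(X, ℝ)))) {m' : X → ℝ}
    {c' : X → X → ℝ} (hm : ∀ x, Tendsto (fun n => m n x) atTop (𝓝 (m' x)))
    (hc : ∀ x y, Tendsto (fun n => c n x y) atTop (𝓝 (c' x y))) :
    ∃ Q : ProbabilityMeasure C(X, ℝ), HasGaussianCharFun Q m' c' := by
  have hcomp : IsCompact (closure (Set.range P)) := isCompact_closure_of_isTightMeasureSet <| by
    refine htight.subset ?_
    rintro _ ⟨_, ⟨n, rfl⟩, rfl⟩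
    exact ⟨n, rfl⟩
  obtain ⟨Q, -, hQ⟩ := hcomp.exists_mapClusterPt_of_frequently
    (Eventually.of_forall fun n => subset_closure ⟨n, rfl⟩ :
      ∀ᶠ n in atTop, P n ∈ closure (Set.range P)).frequently
  exact ⟨Q, .of_mapClusterPt h hm hc hQ⟩

/-! ### Construction of Gaussian laws from feature maps -/

theorem posSemidef_of_inner {X F : Type*} [NormedAddCommGroup F] [InnerProductSpace ℝ F]
    (ξ : X → F) : (Matrix.of fun s t => inner ℝ (ξ s) (ξ t)).PosSemidef := by
  refine ⟨?_, fun v => ?_⟩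
  · ext s t
    simp [real_inner_comm]
  · have h := real_inner_self_nonneg (x := v.sum fun s a => a • ξ s)
    refine h.trans_eq ?_
    simp only [Finsupp.sum, sum_inner, inner_sum, real_inner_smul_left, real_inner_smul_right,
      Matrix.of_apply, star_trivial]
    refine Finset.sum_congr rfl fun i _ => Finset.sum_congr rfl fun j _ => ?_
    rw [real_inner_comm]
    ring

/-- The law of `m + ⟨Z, ξ⟩` for a standard Gaussian vector `Z` in a finite-dimensional space. -/
theorem exists_hasGaussianCharFun_of_finiteDimensional {X : Type u} [TopologicalSpace X]
    {V : Type*} [NormedAddCommGroup V] [InnerProductSpace ℝ V] [FiniteDimensional ℝ V]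
    {ξ : X → V} (hξ : Continuous ξ) (m : C(X, ℝ)) :
    ∃ P : ProbabilityMeasure C(X, ℝ),
      HasGaussianCharFun P m fun s t => inner ℝ (ξ s) (ξ t) := by
  borelize V
  let Φ : C(V, C(X, ℝ)) := ContinuousMap.curry ⟨fun p => m p.2 + inner ℝ p.1 (ξ p.2), by fun_prop⟩
  have hΦ : ∀ z x, Φ z x = m x + inner ℝ z (ξ x) := fun _ _ => rfl
  refine ⟨⟨(stdGaussian V).map Φ,
    Measure.isProbabilityMeasure_map Φ.continuous.measurable.aemeasurable⟩, ?_⟩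
  intro ι _ x θ
  have h1 := charFun_stdGaussian (∑ i, θ i • ξ (x i))
  rw [charFun_apply] at h1
  rw [ProbabilityMeasure.coe_mk, integral_map Φ.continuous.measurable.aemeasurable
    (Continuous.aestronglyMeasurable (by fun_prop))]
  have h2 : ∀ z, Complex.exp ((∑ i, θ i * Φ z (x i) : ℝ) * Complex.I) =
      Complex.exp ((∑ i, θ i * m (x i) : ℝ) * Complex.I) *
        Complex.exp (inner ℝ z (∑ i, θ i • ξ (x i)) * Complex.I) := by
    intro z
    rw [← Complex.exp_add, ← add_mul, ← Complex.ofReal_add]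
    simp only [hΦ, mul_add, Finset.sum_add_distrib, inner_sum, real_inner_smul_right]
  simp_rw [h2]
  rw [integral_const_mul, h1, ← Complex.exp_add, ← Complex.ofReal_pow, ← real_inner_self_eq_norm_sq]
  simp only [sum_inner, inner_sum, real_inner_smul_left, real_inner_smul_right]
  congr 1
  rw [neg_div, ← sub_eq_add_neg]
  simp only [mul_assoc, real_inner_comm]

theorem continuous_of_norm_sub_sq_le {X F : Type*} [PseudoMetricSpace X] [NormedAddCommGroup F]
    {ξ : X → F} {C γ : ℝ} (hγ : 0 < γ) (hξ : ∀ x y, ‖ξ x - ξ y‖ ^ 2 ≤ C * dist x y ^ γ) :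
    Continuous ξ := by
  refine continuous_iff_continuousAt.2 fun x => tendsto_iff_norm_sub_tendsto_zero.2 ?_
  have h1 : Tendsto (fun y => C * dist y x ^ γ) (𝓝 x) (𝓝 0) := by
    have h2 : Tendsto (fun y => dist y x) (𝓝 x) (𝓝 0) := tendsto_iff_dist_tendsto_zero.1 tendsto_id
    simpa [Real.zero_rpow hγ.ne'] using (h2.rpow_const (Or.inr hγ.le)).const_mul C
  have h3 := (squeeze_zero (fun _ => sq_nonneg _) (fun y => hξ y x) h1).sqrt
  simpa [Real.sqrt_sq] using h3

/-- Existence of a continuous Gaussian process whose covariance has a Hölder feature map. -/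
theorem exists_isContGaussianLaw {X : Type u} [MetricSpace X] [CompactSpace X] [Nonempty X]
    {A : ℕ → Finset X} {K R : ℕ} (hAnet : ∀ n s, ∃ a ∈ A n, dist s a ≤ (1 / 2 : ℝ) ^ n)
    (hA : ∀ n, (A n).card ≤ K * R ^ n) {C γ : ℝ} (hC : 0 < C) (hγ : 0 < γ)
    {F : Type*} [NormedAddCommGroup F] [InnerProductSpace ℝ F] [CompleteSpace F]
    {ξ : X → F}
    (hξ : ∀ x y, ‖ξ x - ξ y‖ ^ 2 ≤ C * dist x y ^ γ) (m : C(X, ℝ)) :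
    ∃ P : ProbabilityMeasure C(X, ℝ), IsContGaussianLaw P m fun s t => inner ℝ (ξ s) (ξ t) := by
  have hξc : Continuous ξ := continuous_of_norm_sub_sq_le hγ hξ
  -- Projecting ξ to these finite-dimensional spaces, which exhaust the span of its range up to
  -- closure, keeps the Hölder bound; the resulting laws are tight and a cluster point has the
  -- wanted covariance.
  let S : ℕ → Submodule ℝ F := fun n =>
    Submodule.span ℝ ((fun k => ξ (TopologicalSpace.denseSeq X k)) '' Set.Iic n)
  have hfin : ∀ n, FiniteDimensional ℝ (S n) := fun n =>
    FiniteDimensional.span_of_finite ℝ ((Set.finite_Iic n).image _)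
  have hS : Monotone S := fun n k hnk =>
    Submodule.span_mono (Set.image_mono (Set.Iic_subset_Iic.2 hnk))
  let η : ℕ → X → F := fun n x => (S n).starProjection (ξ x)
  have hηc : ∀ n, Continuous (η n) := fun n => (S n).starProjection.continuous.comp hξc
  have hlim : ∀ x, Tendsto (fun n => η n x) atTop (𝓝 (ξ x)) := by
    intro x
    have h1 : ξ x ∈ (⨆ n, S n).topologicalClosure := by
      rw [← SetLike.mem_coe, Submodule.topologicalClosure_coe]
      refine closure_mono ?_ (hξc.range_subset_closure_image_dense
        (TopologicalSpace.denseRange_denseSeq X) ⟨x, rfl⟩)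
      rintro _ ⟨_, ⟨k, rfl⟩, rfl⟩
      exact Submodule.mem_iSup_of_mem k (Submodule.subset_span ⟨k, Set.self_mem_Iic, rfl⟩)
    have h2 := Submodule.starProjection_tendsto_closure_iSup S hS (ξ x)
    rwa [Submodule.starProjection_eq_self_iff.2 h1] at h2
  have hex : ∀ n, ∃ P : ProbabilityMeasure C(X, ℝ),
      HasGaussianCharFun P m fun s t => inner ℝ (η n s) (η n t) := fun n =>
    exists_hasGaussianCharFun_of_finiteDimensional
      (((S n).orthogonalProjectionOnto.continuous.comp hξc)) m
  choose P hP using hex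
  have hP' : ∀ n, IsContGaussianLaw (P n) m fun s t => inner ℝ (η n s) (η n t) :=
    fun n => (hP n).isContGaussianLaw (posSemidef_of_inner _)
  obtain ⟨B, hB⟩ := (isCompact_range hξc).exists_bound_of_continuousOn
    (f := fun z => ‖z‖ ^ 2) (by fun_prop)
  have htight := isTightMeasureSet_of_isContGaussianLaw (B := B) hAnet hA hC hγ hP' (fun n x y => by
      refine le_trans (le_of_eq_of_le ?_ (pow_le_pow_left₀ (norm_nonneg _)
        ((S n).norm_starProjection_apply_le (ξ x - ξ y)) 2))
        (hξ x y)
      rw [map_sub, norm_sub_sq_real, real_inner_self_eq_norm_sq, real_inner_self_eq_norm_sq])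
    (fun n x => by
      refine le_trans (le_of_eq_of_le ?_ (pow_le_pow_left₀ (norm_nonneg _)
        ((S n).norm_starProjection_apply_le (ξ x)) 2))
        ((le_abs_self _).trans (hB _ ⟨x, rfl⟩))
      rw [real_inner_self_eq_norm_sq])
    isCompact_singleton (fun _ => Set.mem_singleton m)
  obtain ⟨Q, hQ⟩ := HasGaussianCharFun.exists_of_tight hP htight (fun x => tendsto_const_nhds)
    (fun x y => (hlim x).inner (hlim y))
  exact ⟨Q, hQ.isContGaussianLaw (posSemidef_of_inner _)⟩

/-! ### Gram matrices and projections in Hilbert space -/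

section Hilbert

variable {E F : Type*} [NormedAddCommGroup E] [InnerProductSpace ℝ E]
  [NormedAddCommGroup F] [InnerProductSpace ℝ F]

instance Submodule.finiteDimensional_span_range {ι : Type*} [Finite ι] (e : ι → E) :
    FiniteDimensional ℝ (Submodule.span ℝ (Set.range e)) :=
  FiniteDimensional.span_of_finite ℝ (Set.finite_range e)

/-- The orthogonal projection onto the span of finitely many vectors in terms of the inverse of
their Gram matrix. -/
theorem dotProduct_gram_inv_mulVec {ι : Type*} [Fintype ι] [DecidableEq ι] (e : ι → E)
    (he : IsUnit (Matrix.of fun i j => inner ℝ (e i) (e j)).det) (x y : E) :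
    (fun i => inner ℝ x (e i)) ⬝ᵥ
      ((Matrix.of fun i j => inner ℝ (e i) (e j))⁻¹).mulVec (fun j => inner ℝ (e j) y) =
      inner ℝ x ((Submodule.span ℝ (Set.range e)).starProjection y) := by
  set w := ((Matrix.of fun i j => inner ℝ (e i) (e j))⁻¹).mulVec (fun j => inner ℝ (e j) y) with hw
  have hGw : (Matrix.of fun i j => inner ℝ (e i) (e j)).mulVec w = fun j => inner ℝ (e j) y := by
    rw [hw, Matrix.mulVec_mulVec, Matrix.mul_nonsing_inv _ he, Matrix.one_mulVec]
  -- `hGw` is the system of normal equations for the coefficients of the projection.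
  have hP : (Submodule.span ℝ (Set.range e)).starProjection y = ∑ i, w i • e i := by
    refine Submodule.eq_starProjection_of_mem_of_inner_eq_zero
      (Submodule.sum_mem _ fun i _ => Submodule.smul_mem _ _ (Submodule.subset_span ⟨i, rfl⟩)) ?_
    intro v hv
    induction hv using Submodule.span_induction with
    | mem v hv =>
      obtain ⟨i, rfl⟩ := hv
      have h1 := congrFun hGw i
      rw [real_inner_comm, inner_sub_right, ← h1, inner_sum, sub_eq_zero]
      simp [Matrix.mulVec, dotProduct, real_inner_smul_right, mul_comm]
    | zero => simp
    | add v v' _ _ h h' => rw [inner_add_right, h, h', add_zero]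
    | smul a v _ h => rw [real_inner_smul_right, h, mul_zero]
  rw [hP, inner_sum]
  simp [dotProduct, real_inner_smul_right, mul_comm]

/-- If Gv = 0 for the Gram matrix G, then ‖∑ vᵢeᵢ‖² = vᵀGv = 0. -/
theorem isUnit_det_gram {ι : Type*} [Fintype ι] [DecidableEq ι] {e : ι → E}
    (he : LinearIndependent ℝ e) : IsUnit (Matrix.of fun i j => inner ℝ (e i) (e j)).det := by
  rw [isUnit_iff_ne_zero]
  intro h0
  obtain ⟨v, hv, hv0⟩ := Matrix.exists_mulVec_eq_zero_iff.2 h0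
  refine hv (funext (Fintype.linearIndependent_iff.1 he v ?_))
  rw [← inner_self_eq_zero (𝕜 := ℝ), sum_inner]
  refine Finset.sum_eq_zero fun i _ => ?_
  have h1 := congrFun hv0 i
  rw [real_inner_smul_left, inner_sum]
  simp only [real_inner_smul_right]
  simp only [Matrix.mulVec, dotProduct, Matrix.of_apply, Pi.zero_apply] at h1
  rw [← mul_zero (v i), ← h1]
  exact congrArg _ (Finset.sum_congr rfl fun j _ => mul_comm _ _)

variable [CompleteSpace E] [CompleteSpace F]

/-- For an isometric embedding `J` and a closed subspace `V`, the orthogonal projection onto the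
complement of `J V`. -/
noncomputable def embeddingResidual (J : E →ₗᵢ[ℝ] F) (V : Submodule ℝ E)
    [V.HasOrthogonalProjection] :
    F →L[ℝ] F :=
  ContinuousLinearMap.id ℝ F - J.toContinuousLinearMap ∘L V.starProjection ∘L
    J.toContinuousLinearMap.adjoint

/-- Since J*J = 1, the residual is a self-adjoint idempotent. At kernel functions the right side is
the conditional covariance, which thus acquires a feature map. -/
theorem inner_embeddingResidual (J : E →ₗᵢ[ℝ] F) (V : Submodule ℝ E)
    [V.HasOrthogonalProjection] (x y : F) :
    inner ℝ (embeddingResidual J V x) (embeddingResidual J V y) = inner ℝ x y -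
      inner ℝ (J.toContinuousLinearMap.adjoint x)
        (V.starProjection (J.toContinuousLinearMap.adjoint y)) := by
  have h1 : ∀ (z : F) (w : E), inner ℝ z (J w) = inner ℝ (J.toContinuousLinearMap.adjoint z) w :=
    fun z w => (ContinuousLinearMap.adjoint_inner_left J.toContinuousLinearMap w z).symm
  have h2 : ∀ (w : E) (z : F), inner ℝ (J w) z = inner ℝ w (J.toContinuousLinearMap.adjoint z) :=
    fun w z => (ContinuousLinearMap.adjoint_inner_right J.toContinuousLinearMap w z).symm
  have h3 : ∀ u v : E, inner ℝ (V.starProjection u) (V.starProjection v) =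
      inner ℝ u (V.starProjection v) := fun u v => by
    rw [Submodule.inner_starProjection_left_eq_right,
      Submodule.starProjection_eq_self_iff.2 (Submodule.starProjection_apply_mem _ _)]
  have happ : ∀ z, embeddingResidual J V z =
      z - J (V.starProjection (J.toContinuousLinearMap.adjoint z)) := fun _ => rfl
  rw [happ, happ, inner_sub_left, inner_sub_right, inner_sub_right, J.inner_map_map, h1, h2, h3,
    Submodule.inner_starProjection_left_eq_right]
  ring

theorem norm_embeddingResidual_le (J : E →ₗᵢ[ℝ] F) (V : Submodule ℝ E)
    [V.HasOrthogonalProjection] (x : F) :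
    ‖embeddingResidual J V x‖ ≤ ‖x‖ := by
  have h := inner_embeddingResidual J V x x
  rw [← sq_le_sq₀ (norm_nonneg _) (norm_nonneg _), ← real_inner_self_eq_norm_sq, h,
    real_inner_self_eq_norm_sq]
  have h1 := V.re_inner_starProjection_nonneg (J.toContinuousLinearMap.adjoint x)
  rw [Submodule.inner_starProjection_left_eq_right] at h1
  exact sub_le_self _ h1

end Hilbert

/-! ### Kernel functions, embedding of H(S), and universality -/

namespace CovKernel

variable {X : Type*} (k : CovKernel X)

/-- The kernel function `k(·, s)` as an element of `H(X)`. -/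
noncomputable def feature (s : X) : k.H := RKHS.kerFun k.H s (1 : ℝ)

theorem inner_feature (u : k.H) (s : X) : inner ℝ u (k.feature s) = u s := k.inner_kerFun u s

theorem inner_feature_feature (s t : X) : inner ℝ (k.feature s) (k.feature t) = k s t := by
  rw [inner_feature, feature, kerFun_apply, k.symm]

theorem dense_span_feature : (Submodule.span ℝ (Set.range k.feature)).topologicalClosure = ⊤ := by
  rw [← RKHS.kerFun_dense (H := k.H) (𝕜 := ℝ)]
  congr 1
  apply le_antisymm
  · refine Submodule.span_mono ?_
    rintro _ ⟨s, rfl⟩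
    exact ⟨s, 1, rfl⟩
  · refine Submodule.span_le.2 ?_
    rintro _ ⟨s, v, rfl⟩
    have : RKHS.kerFun k.H s v = v • k.feature s := by
      rw [feature, ← map_smul, smul_eq_mul, mul_one]
    rw [this]
    exact Submodule.smul_mem _ _ (Submodule.subset_span ⟨s, rfl⟩)

/-- The isometric embedding of `H(S)` into `H(X)` that maps kernel functions to kernel functions. -/
theorem exists_embedding (S : Set X) : ∃ J : (k.restrict S).H →ₗᵢ[ℝ] k.H,
    ∀ a : S, J ((k.restrict S).feature a) = k.feature a := by
  let Φ : (S →₀ ℝ) →ₗ[ℝ] (k.restrict S).H := Finsupp.linearCombination ℝ (k.restrict S).feature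
  let Ψ : (S →₀ ℝ) →ₗ[ℝ] k.H := Finsupp.linearCombination ℝ fun x : S => k.feature x
  have hnorm : ∀ c, ‖Ψ c‖ = ‖Φ c‖ := fun c => by
    rw [← sq_eq_sq₀ (norm_nonneg _) (norm_nonneg _), ← real_inner_self_eq_norm_sq,
      ← real_inner_self_eq_norm_sq]
    simp only [Φ, Ψ, Finsupp.linearCombination_apply, Finsupp.sum_inner, Finsupp.inner_sum,
      real_inner_smul_left, real_inner_smul_right, inner_feature_feature]
    rfl
  have hdense : DenseRange Φ := by
    have h1 := (k.restrict S).dense_span_feature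
    rw [← Finsupp.range_linearCombination] at h1
    exact Submodule.dense_iff_topologicalClosure_eq_top.2 h1
  have hbound : ∀ c, ‖Ψ c‖ ≤ 1 * ‖Φ c‖ := fun c => by rw [hnorm, one_mul]
  let J := Ψ.extendOfNorm Φ
  have hJ : ∀ c, J (Φ c) = Ψ c := LinearMap.extendOfNorm_eq hdense ⟨1, hbound⟩
  refine ⟨⟨J.toLinearMap, fun u => ?_⟩, fun a => ?_⟩
  · refine hdense.induction_on (p := fun u => ‖J u‖ = ‖u‖) u
      (isClosed_eq (by fun_prop) (by fun_prop)) fun c => ?_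
    rw [hJ, hnorm]
  · have h1 := hJ (Finsupp.single a 1)
    simpa [Φ, Ψ] using h1

variable {k}

/-- `k(s, ·)` restricted to `S` is the image of the kernel function at `s` under the adjoint of the
embedding. -/
theorem lift_eq_adjoint {S : Set X} {J : (k.restrict S).H →ₗᵢ[ℝ] k.H}
    (hJ : ∀ a : S, J ((k.restrict S).feature a) = k.feature a) (s : X) :
    (k.restrict S).lift (fun t => k s t) = J.toContinuousLinearMap.adjoint (k.feature s) := by
  refine DFunLike.coe_injective ?_
  rw [coe_lift (k.mem_restrict S s)]
  funext a
  rw [← inner_feature, ContinuousLinearMap.adjoint_inner_left]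
  exact ((congrArg _ (hJ a)).trans (k.inner_feature_feature s a)).symm

theorem Mem.sub {f g : X → ℝ} (hf : k.Mem f) (hg : k.Mem g) : k.Mem fun x => f x - g x := by
  obtain ⟨u, rfl⟩ := hf
  obtain ⟨v, rfl⟩ := hg
  exact ⟨u - v, RKHS.coe_sub u v⟩

/-- The feature vectors of a universal kernel on a subset of a compact space are linearly
independent. -/
theorem IsUniversal.linearIndependent {X : Type*} [MetricSpace X] [CompactSpace X]
    {k : CovKernel X} {S : Set X} (h : (k.restrict S).IsUniversal) :
    LinearIndependent ℝ (k.restrict S).feature := by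
  rw [linearIndependent_iff']
  intro I c hc
  have hc' : ∀ u : (k.restrict S).H, ∑ a ∈ I, c a * u a = 0 := by
    intro u
    have h1 := congrArg (inner ℝ u) hc
    simpa only [inner_sum, real_inner_smul_right, inner_feature, inner_zero_right] using h1
  let D : Set X := (fun a : S => (a : X)) '' I
  have hD : D.Finite := I.finite_toSet.image _
  have : Finite D := hD
  -- Tietze extension of the coefficients. As `c` annihilates every u in H(S), ∑ c² = ∑ c(f - u),
  -- which is small when u approximates f uniformly.
  obtain ⟨f, hf⟩ : ∃ f : C(X, ℝ), ∀ a ∈ I, f a = c a := by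
    classical
    obtain ⟨f, hf⟩ := ContinuousMap.exists_restrict_eq hD.isClosed
      (⟨fun x : D => if hx : (x : X) ∈ S then c ⟨x, hx⟩ else 0, continuous_of_discreteTopology⟩ :
        C(D, ℝ))
    refine ⟨f, fun a ha => ?_⟩
    have := congrArg (fun F => F ⟨a, a, ha, rfl⟩) hf
    simpa using this
  have hsum : ∑ a ∈ I, c a ^ 2 ≤ 0 := by
    refine le_of_forall_pos_le_add fun ε hε => ?_
    have hpos : 0 < ∑ a ∈ I, |c a| + 1 := by positivity
    obtain ⟨u, hu⟩ := h (fun a : S => f a)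
      ((CompactSpace.uniformContinuous_of_continuous f.continuous).comp
        uniformContinuous_subtype_val)
      (ε / (∑ a ∈ I, |c a| + 1)) (by positivity)
    calc ∑ a ∈ I, c a ^ 2 = ∑ a ∈ I, c a * (f a - u a) := by
          simp only [mul_sub, Finset.sum_sub_distrib, hc', sub_zero]
          exact Finset.sum_congr rfl fun a ha => by rw [hf a ha, sq]
      _ ≤ ∑ a ∈ I, |c a| * (ε / (∑ a ∈ I, |c a| + 1)) := by
          refine Finset.sum_le_sum fun a _ => (le_abs_self _).trans ?_
          rw [abs_mul, abs_sub_comm]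
          gcongr
          exact (hu a).le
      _ ≤ 0 + ε := by
          rw [← Finset.sum_mul, ← mul_div_assoc, div_le_iff₀ hpos]
          nlinarith
  intro a ha
  have h0 := (Finset.sum_eq_zero_iff_of_nonneg fun a _ => sq_nonneg (c a)).1
    (hsum.antisymm (Finset.sum_nonneg fun a _ => sq_nonneg (c a))) a ha
  exact pow_eq_zero_iff two_ne_zero |>.1 h0

end CovKernel

namespace CovKernel

section

variable {X : Type*} {k : CovKernel X}

theorem inner_feature_lift {f : X → ℝ} (hf : k.Mem f) (s : X) :
    inner ℝ (k.feature s) (k.lift f) = f s := by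
  rw [real_inner_comm, inner_feature, coe_lift hf]

theorem inner_lift_feature_restrict {S : Set X} (s : X) (a : S) :
    inner ℝ ((k.restrict S).lift fun t => k s t) ((k.restrict S).feature a) = k s a := by
  rw [inner_feature, coe_lift (k.mem_restrict S s)]

end

section

variable {X : Type*} [DecidableEq X] {k : CovKernel X} {S : Set X} {I : Finset X}
  (hI : ∀ a ∈ I, a ∈ S)

/-- The conditioning formulas express orthogonal projection onto the span of kernel functions. -/
theorem dotProduct_inv_mulVec_eq_inner (hli : LinearIndependent ℝ (k.restrict S).feature)
    {f : X → ℝ} (hf : (k.restrict S).Mem fun a => f a) (s : X) :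
    (fun a : I => k s a) ⬝ᵥ ((Matrix.of fun a b : I => k a b)⁻¹).mulVec (fun b : I => f b) =
      inner ℝ ((k.restrict S).lift fun t => k s t)
        ((Submodule.span ℝ (Set.range fun a : I => (k.restrict S).feature
          ⟨a, hI a a.2⟩)).starProjection ((k.restrict S).lift fun a => f a)) := by
  have hli' : LinearIndependent ℝ fun a : I => (k.restrict S).feature ⟨a, hI a a.2⟩ :=
    hli.comp (fun a : I => ⟨a, hI a a.2⟩) fun a b hab =>
      Subtype.ext (congrArg (fun z : S => (z : X)) hab)
  rw [← dotProduct_gram_inv_mulVec _ (isUnit_det_gram hli')]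
  simp only [inner_lift_feature_restrict, inner_feature_feature, inner_feature_lift hf]
  rfl

theorem condMean_eq (hli : LinearIndependent ℝ (k.restrict S).feature)
    {μ g : X → ℝ} (hgμ : (k.restrict S).Mem fun a => g a - μ a) (s : X) :
    k.condMean μ g I s = μ s + inner ℝ ((k.restrict S).lift fun t => k s t)
        ((Submodule.span ℝ (Set.range fun a : I => (k.restrict S).feature
          ⟨a, hI a a.2⟩)).starProjection ((k.restrict S).lift fun a => g a - μ a)) :=
  congrArg _ (dotProduct_inv_mulVec_eq_inner hI hli (f := fun a => g a - μ a) hgμ s)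

theorem condCov_eq (hli : LinearIndependent ℝ (k.restrict S).feature) (s s' : X) :
    k.condCov I s s' = k s s' - inner ℝ ((k.restrict S).lift fun t => k s t)
        ((Submodule.span ℝ (Set.range fun a : I => (k.restrict S).feature
          ⟨a, hI a a.2⟩)).starProjection ((k.restrict S).lift fun t => k s' t)) := by
  rw [← dotProduct_inv_mulVec_eq_inner hI hli (k.mem_restrict S s'), condCov]
  simp only [k.symm _ s']

end

theorem norm_feature_sub_sq {X : Type*} (k : CovKernel X) (s t : X) :
    ‖k.feature s - k.feature t‖ ^ 2 = k s s - 2 * k s t + k t t := by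
  rw [norm_sub_sq_real, ← real_inner_self_eq_norm_sq, ← real_inner_self_eq_norm_sq,
    inner_feature_feature, inner_feature_feature, inner_feature_feature]

/-- The square is (k(s,s) - k(s,t)) + (k(t,t) - k(s,t)), and each difference moves one argument
only. -/
theorem norm_feature_sub_sq_le {X : Type*} [PseudoMetricSpace X] {k : CovKernel X} {C γ : ℝ≥0}
    (hk : HolderWith C γ fun p : X × X => k p.1 p.2) (s t : X) :
    ‖k.feature s - k.feature t‖ ^ 2 ≤ 2 * C * dist s t ^ (γ : ℝ) := by
  have h1 := hk.dist_le (s, s) (s, t)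
  have h2 := hk.dist_le (t, t) (s, t)
  rw [dist_prod_same_left, Real.dist_eq] at h1
  rw [dist_prod_same_right, Real.dist_eq, dist_comm t s] at h2
  rw [norm_feature_sub_sq]
  linarith [le_abs_self (k s s - k s t), le_abs_self (k t t - k s t)]

end CovKernel

/-! ### Projections at the observed points and the main theorem -/

theorem mem_of_mem_firstPoints {X : Type*} [DecidableEq X] {S : Set X} {t : ℕ → S} {N : ℕ} :
    ∀ a ∈ firstPoints t N, a ∈ S := by
  intro a ha
  obtain ⟨n, -, rfl⟩ := Finset.mem_image.1 ha
  exact (t n).2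

namespace CovKernel

variable {X : Type*} [DecidableEq X] (k : CovKernel X) {S : Set X} (t : ℕ → S)

/-- The span in `H(S)` of the kernel functions at the first `N` points. -/
noncomputable def pointSpan (N : ℕ) : Submodule ℝ (k.restrict S).H :=
  Submodule.span ℝ (Set.range fun a : firstPoints t N =>
    (k.restrict S).feature ⟨a, mem_of_mem_firstPoints (t := t) a a.2⟩)

instance (N : ℕ) : FiniteDimensional ℝ (k.pointSpan t N) :=
  Submodule.finiteDimensional_span_range _

theorem monotone_pointSpan : Monotone (k.pointSpan t) := by
  intro N M hNM
  refine Submodule.span_mono ?_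
  rintro _ ⟨a, rfl⟩
  exact ⟨⟨a, Finset.image_mono _ (Finset.range_mono hNM) a.2⟩, rfl⟩

theorem feature_mem_pointSpan (n : ℕ) : (k.restrict S).feature (t n) ∈ k.pointSpan t (n + 1) :=
  Submodule.subset_span ⟨⟨t n, Finset.mem_image_of_mem _ (Finset.self_mem_range_succ n)⟩, rfl⟩

/-- The kernel functions at a dense sequence of points span a dense subspace. -/
theorem tendsto_starProjection_pointSpan [TopologicalSpace X] (ht : DenseRange t)
    (hc : Continuous (k.restrict S).feature) (u : (k.restrict S).H) :
    Tendsto (fun N => (k.pointSpan t N).starProjection u) atTop (𝓝 u) := by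
  refine Submodule.starProjection_tendsto_self _ (k.monotone_pointSpan t) u ?_
  rw [← (k.restrict S).dense_span_feature]
  refine Submodule.topologicalClosure_minimal _ (Submodule.span_le.2 ?_)
    (Submodule.isClosed_topologicalClosure _)
  refine (hc.range_subset_closure_image_dense ht).trans ?_
  rw [Submodule.topologicalClosure_coe]
  refine closure_mono ?_
  rintro _ ⟨_, ⟨n, rfl⟩, rfl⟩
  exact Submodule.mem_iSup_of_mem _ (k.feature_mem_pointSpan t n)

end CovKernel

theorem theorem4p2 {d : ℕ} {T : Set (EuclideanSpace ℝ (Fin d))} [DecidableEq T] (hT : IsCompact T)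
    (T₀ : Set T) (k : CovKernel T) {γ : ℝ≥0} (hγ : 0 < γ)
    (hk : ∃ C : ℝ≥0, HolderWith C γ fun p : T × T => k p.1 p.2)
    (huniv : (k.restrict T₀).IsUniversal)
    (μ : C(T, ℝ)) (g : T → ℝ)
    (hg : (k.restrict T₀).Mem fun s => g s) (hμ : (k.restrict T₀).Mem fun s => μ s)
    (t : ℕ → T₀) (ht : DenseRange t) :
    (∀ N : ℕ, ∃ P : ProbabilityMeasure C(T, ℝ), IsContGaussianLaw P
      (k.condMean μ g (firstPoints t N))
      (k.condCov (firstPoints t N))) ∧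
    (∃ Q : ProbabilityMeasure C(T, ℝ), IsContGaussianLaw Q (k.limMean μ g T₀) (k.limCov T₀)) ∧
    ∀ P : ℕ → ProbabilityMeasure C(T, ℝ),
      (∀ N : ℕ, IsContGaussianLaw (P N)
        (k.condMean μ g (firstPoints t N))
        (k.condCov (firstPoints t N))) →
      IsTightMeasureSet (Set.range fun N => (P N : Measure C(T, ℝ))) ∧
      ∀ Q : ProbabilityMeasure C(T, ℝ), IsContGaussianLaw Q (k.limMean μ g T₀) (k.limCov T₀) →
        Tendsto P atTop (𝓝 Q) := by
  have : CompactSpace T := isCompact_iff_compactSpace.1 hT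
  have : Nonempty T := ⟨t 0⟩
  obtain ⟨C₀, hC₀⟩ := hk
  obtain ⟨A, K, R, hAnet, hA⟩ := EuclideanSpace.exists_nets_card_le hT.isBounded
  have hγ' : (0 : ℝ) < γ := hγ
  set C : ℝ := 2 * C₀ + 1
  have hC : 0 < C := by positivity
  have hψ : ∀ x y, ‖k.feature x - k.feature y‖ ^ 2 ≤ C * dist x y ^ (γ : ℝ) := fun x y =>
    (CovKernel.norm_feature_sub_sq_le hC₀ x y).trans (by gcongr; simp [C])
  have hψc := continuous_of_norm_sub_sq_le hγ' hψ
  obtain ⟨J, hJ⟩ := k.exists_embedding T₀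
  let φ : T → (k.restrict T₀).H := fun s => (k.restrict T₀).lift fun a => k s a
  have hφ : ∀ s, φ s = J.toContinuousLinearMap.adjoint (k.feature s) := CovKernel.lift_eq_adjoint hJ
  have hφc : Continuous φ := by
    simp_rw [funext hφ]
    fun_prop
  have hfeat : Continuous (k.restrict T₀).feature := by
    refine J.isometry.isEmbedding.continuous_iff.2 ?_
    rw [Function.comp_def, funext hJ]
    fun_prop
  have hli := huniv.linearIndependent
  let u := (k.restrict T₀).lift fun a => g a - μ a
  -- Both kinds of mean are values of this continuous affine map, at P_N u and at u, so convergence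
  -- in H(T₀) gives uniform convergence of the means.
  let Λ : C((k.restrict T₀).H, C(T, ℝ)) :=
    ContinuousMap.curry ⟨fun p => μ p.2 + inner ℝ (φ p.2) p.1, by fun_prop⟩
  -- One feature map for all covariances: V = `pointSpan` gives the conditional ones, V = ⊤ the
  -- limit.
  let ξ : (V : Submodule ℝ (k.restrict T₀).H) → [V.HasOrthogonalProjection] → T → k.H :=
    fun V _ s => embeddingResidual J V (k.feature s)
  have hξ : ∀ (V : Submodule ℝ (k.restrict T₀).H) [V.HasOrthogonalProjection] (x y : T),
      inner ℝ (ξ V x) (ξ V y) = k x y - inner ℝ (φ x) (V.starProjection (φ y)) := by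
    intro V _ x y
    rw [inner_embeddingResidual, CovKernel.inner_feature_feature, hφ, hφ]
  have hξ_le : ∀ (V : Submodule ℝ (k.restrict T₀).H) [V.HasOrthogonalProjection] (x y : T),
      ‖ξ V x - ξ V y‖ ^ 2 ≤ C * dist x y ^ (γ : ℝ) := by
    intro V _ x y
    simp only [ξ]
    rw [← map_sub]
    exact (pow_le_pow_left₀ (norm_nonneg _) (norm_embeddingResidual_le J V _) 2).trans (hψ x y)
  have hmean : ∀ N, k.condMean μ g (firstPoints t N) = Λ ((k.pointSpan t N).starProjection u) :=
    fun N => funext fun s => CovKernel.condMean_eq (I := firstPoints t N) (S := T₀)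
      mem_of_mem_firstPoints hli (hg.sub hμ) s
  have hcov : ∀ N, k.condCov (firstPoints t N) =
      fun x y => inner ℝ (ξ (k.pointSpan t N) x) (ξ (k.pointSpan t N) y) :=
    fun N => funext fun x => funext fun y => (CovKernel.condCov_eq (I := firstPoints t N) (S := T₀)
      mem_of_mem_firstPoints hli x y).trans (hξ _ x y).symm
  have hlmean : k.limMean μ g T₀ = Λ u := rfl
  have hlcov : k.limCov T₀ = fun x y => inner ℝ (ξ ⊤ x) (ξ ⊤ y) := by
    funext x y
    rw [hξ, Submodule.starProjection_top]
    rfl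
  have hu := k.tendsto_starProjection_pointSpan t ht hfeat
  have hΛu : Tendsto (fun N => Λ ((k.pointSpan t N).starProjection u)) atTop (𝓝 (Λ u)) :=
    (Λ.continuous.tendsto u).comp (hu u)
  refine ⟨fun N => ?_, ?_, fun P hP => ?_⟩
  · rw [hmean, hcov]
    exact exists_isContGaussianLaw hAnet hA hC hγ' (hξ_le _) _
  · rw [hlmean, hlcov]
    exact exists_isContGaussianLaw hAnet hA hC hγ' (hξ_le _) _
  · simp_rw [hmean, hcov] at hP
    obtain ⟨B, hB⟩ := (isCompact_range hψc).exists_bound_of_continuousOn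
      (f := fun z => ‖z‖ ^ 2) (by fun_prop)
    have htight := isTightMeasureSet_of_isContGaussianLaw (B := B) hAnet hA hC hγ' hP
      (fun N x y => by
        refine le_of_eq_of_le ?_ (hξ_le (k.pointSpan t N) x y)
        rw [norm_sub_sq_real, real_inner_self_eq_norm_sq, real_inner_self_eq_norm_sq])
      (fun N x => by
        rw [real_inner_self_eq_norm_sq]
        exact (pow_le_pow_left₀ (norm_nonneg _) (norm_embeddingResidual_le J _ _) 2).trans
          ((le_abs_self _).trans (hB _ ⟨x, rfl⟩)))
      -- The convergent sequence of means together with its limit is the compact set required for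
      -- tightness.
      hΛu.isCompact_insert_range (fun N => Set.mem_insert_of_mem _ ⟨N, rfl⟩)
    refine ⟨htight, fun Q hQ => ?_⟩
    rw [hlmean, hlcov] at hQ
    refine HasGaussianCharFun.tendsto (fun N => (hP N).hasGaussianCharFun) htight
      (fun x => ((continuous_eval_const x).tendsto (Λ u)).comp hΛu) (fun x y => ?_)
      hQ.hasGaussianCharFun
    simp_rw [hξ, Submodule.starProjection_top]
    exact tendsto_const_nhds.sub (tendsto_const_nhds.inner (hu (φ y)))
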